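/- **Setting.** Let $\varphi_0(z)=e^z$, $\varphi_{k+1}(z)=\dfrac{\varphi_k(z)-\varphi_k(0)}{z}$, $\varphi_k(0)=\dfrac1{k!}$. Consider the two explicit three-stage exponential Runge--Kutta schemes with nodes $c_1,c_2,c_3$ and coefficient functions $a_{ij}(z)$, $b_j(z)$ given by * (EDETDRK3): $c=(0,1,\tfrac23)$, $a_{21}=\varphi_1(z)$, $a_{31}=\tfrac23\varphi_1(\tfrac23z)-\tfrac49\varphi_2(\tfrac23z)$, $a_{32}=\tfrac49\varphi_2(\tfrac23z)$, $b_1=\tfrac34\varphi_1(z)-\varphi_2(z)$, $b_2=\varphi_2(z)-\tfrac12\varphi_1(z)$, $b_3=\tfrac34\varphi_1(z)$; * (EDETDRK3b): $c=(0,\tfrac49,\tfrac23)$, $a_{21}=\tfrac49\varphi_1(\tfrac49z)$, $a_{31}=\tfrac23\varphi_1(\tfrac23z)-\varphi_2(\tfrac23z)$, $a_{32}=\varphi_2(\tfrac23z)$, $b_1=\varphi_1(z)-\tfrac32\varphi_2(z)$, $b_2=0$, $b_3=\tfrac32\varphi_2(z)$. For each scheme put $$P=\begin{pmatrix}a_{21}&0&0\\a_{31}&a_{32}&0\\b_1&b_2&b_3\end{pmatrix},\qquad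 \Delta'(z)=zPEP^T+E_LP^T+PE_L^T,$$ where $E$ is the $3\times3$ all-ones matrix and $E_L$ the lower triangular all-ones matrix. A *gradient flow* is an equation $u_t=G(\mathcal Lu+f(u))=G(Lu-g(u))$ in a real Hilbert space $H$, with $L=\beta I+\mathcal L$ and $g(u)=\beta u-f(u)$, where $G$ and $\mathcal L$ are (possibly unbounded) self-adjoint operators, $(Gx,x)\le0$ for $x\in D(G)$, $L$ is positive definite ($(Lx,x)\ge\kappa\|x\|^2$ on $D(\mathcal L)$ for some $\kappa>0$), $f:H\to H$ is the gradient of a functional $F:H\to\mathbb R$ and is Lipschitz continuous with constant $\beta$, and $GL$, with domain $\{x\in D(\mathcal L): Lx\in D(G)\}$, generates a strongly continuous semigroup $e^{tGL}$ on $H$. Its energy is $E(u)=\tfrac12(\mathcal Lu,u)+F(u)$, $u\in D(\mathcal L)$. One step of a scheme with step size $\tau>0$ maps $u_n$ to $u_{n+1}$, where $$v_i=e^{c_i\tau GL}u_n-\tau\sum_{j<i}a_{ij}(\tau GL)\,G\,g(v_j)\quad(i=1,2,3),\qquad u_{n+1}=e^{\tau GL}u_n-\tau\sum_{j=1}^3b_j(\tau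 GL)\,G\,g(v_j).$$ Here $\varphi_{k+1}(tGL)=\int_0^1\frac{\theta^k}{k!}e^{(1-\theta)tGL}\,d\theta$ for $k\ge 0$, and for $k\ge1$, $t>0$ the operator $\varphi_k(tGL)\,G$ is extended from $D(G)$ to $H$ by $\varphi_k(tGL)\,G=t^{-1}\bigl(\varphi_{k-1}(tGL)-\tfrac1{(k-1)!}I\bigr)L^{-1}$. **Proposition.** For each of the schemes (EDETDRK3) and (EDETDRK3b), all leading principal minors of $\Delta'(z)$ are positive for every $z<0$, and hence $\Delta'(z)$ is positive definite for every $z<0$. Moreover, both schemes decrease the energy unconditionally: for every gradient flow as above, every $\tau>0$ and every $u_n\in D(\mathcal L)$, one has $u_{n+1}\in D(\mathcal L)$ and $E(u_{n+1})\le E(u_n)$. -/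

import Mathlib

open Filter Topology
open scoped Matrix Nat RealInnerProductSpace

universe w

noncomputable section

namespace ETDRK

/-! ## Exponential functions and Butcher tableaux -/

/-- The functions `φ₀ z = e ^ z`, `φ_{k+1} z = (φ_k z - φ_k 0) / z`, with `φ_k 0 = 1 / k!`. -/
def phi : ℕ → ℝ → ℝ
  | 0, z => Real.exp z
  | k + 1, z => if z = 0 then 1 / ((k + 1)! : ℝ) else (phi k z - 1 / (k ! : ℝ)) / z

/-- The formal expression `q * φ_k (c z)` with `k ≥ 1`. It can be evaluated at a real number `z`
(`PhiTerm.eval`) and, multiplied by `G`, at the operator `τ G L` (`PhiTerm.opG`). -/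
structure PhiTerm where
  q : ℝ
  k : ℕ
  c : ℝ
  one_le_k : 1 ≤ k

/-- The value of the expression `q * φ_k (c z)` at the real number `z`. -/
def PhiTerm.eval (p : PhiTerm) (z : ℝ) : ℝ := p.q * phi p.k (p.c * z)

/-- A coefficient of a scheme: a formal sum of terms `q * φ_k (c z)`; `[]` is zero. -/
abbrev Coeff := List PhiTerm

/-- The value of a coefficient at the real number `z`. -/
def Coeff.eval (h : Coeff) (z : ℝ) : ℝ := (h.map fun p => p.eval z).sum

/-- The Butcher tableau of an explicit `s`-stage exponential Runge--Kutta scheme (only the entries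
`a i j` with `j < i` are used). -/
structure Tableau (s : ℕ) where
  c : Fin s → ℝ
  a : Fin s → Fin s → Coeff
  b : Fin s → Coeff

/-- The lower triangular matrix `P`: its first `s - 1` rows are the rows `2, …, s` of `a`, its last
row is `b`. -/
def Tableau.P {s : ℕ} (tab : Tableau s) (z : ℝ) : Matrix (Fin s) (Fin s) ℝ :=
  Matrix.of fun i j =>
    if h : (i : ℕ) + 1 < s then
      if j ≤ i then (tab.a ⟨i + 1, h⟩ j).eval z else 0
    else (tab.b j).eval z

/-- The all-ones matrix `E`. -/
def matE (s : ℕ) : Matrix (Fin s) (Fin s) ℝ := Matrix.of fun _ _ => 1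

/-- The lower triangular all-ones matrix `E_L`. -/
def matEL (s : ℕ) : Matrix (Fin s) (Fin s) ℝ := Matrix.of fun i j => if j ≤ i then 1 else 0

/-- The symmetric matrix `Δ'(z) = z P E Pᵀ + E_L Pᵀ + P E_Lᵀ`. -/
def Tableau.Delta' {s : ℕ} (tab : Tableau s) (z : ℝ) : Matrix (Fin s) (Fin s) ℝ :=
  z • (tab.P z * matE s * (tab.P z)ᵀ) + matEL s * (tab.P z)ᵀ + tab.P z * (matEL s)ᵀ

/-- `term q k c` is the formal expression `q * φ_k (c z)`. -/
def term (q : ℝ) (k : ℕ) (c : ℝ) (hk : 1 ≤ k := by norm_num) : PhiTerm := ⟨q, k, c, hk⟩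

/-- The first third-order scheme:
`0   |`
`1   | φ₁`
`2/3 | (2/3) φ₁(2z/3) - (4/9) φ₂(2z/3)   (4/9) φ₂(2z/3)`
`b   | (3/4) φ₁ - φ₂   φ₂ - (1/2) φ₁   (3/4) φ₁`. -/
def EDETDRK3 : Tableau 3 where
  c := ![0, 1, 2 / 3]
  a := ![![[], [], []],
         ![[term 1 1 1], [], []],
         ![[term (2 / 3) 1 (2 / 3), term (-(4 / 9)) 2 (2 / 3)], [term (4 / 9) 2 (2 / 3)], []]]
  b := ![[term (3 / 4) 1 1, term (-1) 2 1], [term 1 2 1, term (-(1 / 2)) 1 1], [term (3 / 4) 1 1]]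

/-- The second third-order scheme:
`0   |`
`4/9 | (4/9) φ₁(4z/9)`
`2/3 | (2/3) φ₁(2z/3) - φ₂(2z/3)   φ₂(2z/3)`
`b   | φ₁ - (3/2) φ₂   0   (3/2) φ₂`. -/
def EDETDRK3b : Tableau 3 where
  c := ![0, 4 / 9, 2 / 3]
  a := ![![[], [], []],
         ![[term (4 / 9) 1 (4 / 9)], [], []],
         ![[term (2 / 3) 1 (2 / 3), term (-1) 2 (2 / 3)], [term 1 2 (2 / 3)], []]]
  b := ![[term 1 1 1, term (-(3 / 2)) 2 1], [], [term (3 / 2) 2 1]]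

/-! ## Unbounded operators and semigroups -/

section Operators

variable {H : Type*} [NormedAddCommGroup H] [InnerProductSpace ℝ H]

/-- The product `A B` of two unbounded operators, on `{x ∈ D(B) | B x ∈ D(A)}`. -/
def opMul (A B : H →ₗ.[ℝ] H) : H →ₗ.[ℝ] H where
  domain :=
    { carrier := {x | ∃ h : x ∈ B.domain, B ⟨x, h⟩ ∈ A.domain}
      add_mem' := by
        rintro x y ⟨hx, hx'⟩ ⟨hy, hy'⟩
        refine ⟨B.domain.add_mem hx hy, ?_⟩
        have := B.map_add ⟨x, hx⟩ ⟨y, hy⟩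
        exact this ▸ A.domain.add_mem hx' hy'
      zero_mem' := by
        refine ⟨B.domain.zero_mem, ?_⟩
        have : B ⟨0, B.domain.zero_mem⟩ = 0 := B.map_zero
        rw [this]
        exact A.domain.zero_mem
      smul_mem' := by
        rintro r x ⟨hx, hx'⟩
        refine ⟨B.domain.smul_mem r hx, ?_⟩
        have := B.map_smul r ⟨x, hx⟩
        exact this ▸ A.domain.smul_mem r hx' }
  toFun :=
    { toFun := fun x => A ⟨B ⟨x, x.2.choose⟩, x.2.choose_spec⟩
      map_add' := by
        intro x y
        rw [← A.map_add]
        congr 1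
        exact Subtype.ext (B.map_add ⟨x, x.2.choose⟩ ⟨y, y.2.choose⟩)
      map_smul' := by
        intro r x
        rw [RingHom.id_apply, ← A.map_smul]
        congr 1
        exact Subtype.ext (B.map_smul r ⟨x, x.2.choose⟩) }

open Classical in
/-- The inverse of an unbounded operator `L`: `opInv L w` is the `x ∈ D(L)` with `L x = w`. It is
used for injective `L` with range `H` only (elsewhere the value is `0`). -/
def opInv (L : H →ₗ.[ℝ] H) (w : H) : H :=
  if h : ∃ x : L.domain, L x = w then (h.choose : H) else 0

/-- `T t = e ^ (t A)` for `t ≥ 0`: the family `T` is a strongly continuous semigroup and `A`, with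
its full domain, is its infinitesimal generator. -/
structure IsSemigroupOf (A : H →ₗ.[ℝ] H) (T : ℝ → H →L[ℝ] H) : Prop where
  zero : T 0 = 1
  add : ∀ s t : ℝ, 0 ≤ s → 0 ≤ t → T (s + t) = (T s).comp (T t)
  continuousOn : ∀ x : H, ContinuousOn (fun t => T t x) (Set.Ici 0)
  mem_graph_iff : ∀ x y : H, (x, y) ∈ A.graph ↔
    Tendsto (fun t : ℝ => t⁻¹ • (T t x - x)) (𝓝[>] 0) (𝓝 y)

/-- The operator `φ_k (t A)`, `t ≥ 0`, for `T t = e ^ (t A)`: `φ₀ (t A) = e ^ (t A)` and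
`φ_{k+1} (t A) x = ∫₀¹ (θ ^ k / k!) e ^ ((1 - θ) t A) x dθ`. -/
def phiOp (T : ℝ → H →L[ℝ] H) : ℕ → ℝ → H → H
  | 0, t, x => T t x
  | k + 1, t, x => ∫ θ in (0 : ℝ)..1, (θ ^ k / (k ! : ℝ)) • T ((1 - θ) * t) x

/-- The operator `φ_k (t G L) G` on all of `H`, for `k ≥ 1` and `t > 0`. Since
`t φ_k (t A) A = φ_{k-1} (t A) - 1 / (k-1)!` on `D(A)`, with `A = G L`, and `G = A L⁻¹` on `D(G)`,
its continuous extension from the dense subspace `D(G)` to `H` is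
`w ↦ t⁻¹ (φ_{k-1} (t G L) - 1 / (k-1)!) L⁻¹ w`. Here `T t = e ^ (t G L)`. -/
def phiOpG (L : H →ₗ.[ℝ] H) (T : ℝ → H →L[ℝ] H) (k : ℕ) (t : ℝ) (w : H) : H :=
  t⁻¹ • (phiOp T (k - 1) t (opInv L w) - (1 / ((k - 1)! : ℝ)) • opInv L w)

/-- The operator `q φ_k (c τ G L) G`. -/
def PhiTerm.opG (p : PhiTerm) (L : H →ₗ.[ℝ] H) (T : ℝ → H →L[ℝ] H) (τ : ℝ) (w : H) : H :=
  p.q • phiOpG L T p.k (p.c * τ) w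

/-- The operator `h (τ G L) G` for a coefficient `h`. -/
def Coeff.opG (h : Coeff) (L : H →ₗ.[ℝ] H) (T : ℝ → H →L[ℝ] H) (τ : ℝ) (w : H) : H :=
  (h.map fun p => p.opG L T τ w).sum

/-- One step `u ↦ u'`, with step size `τ`, stages `v` and `T t = e ^ (t G L)`, of the scheme with
tableau `tab` for the equation `u_t = G (L u - g u)`:
`v_i = e ^ (c_i τ G L) u - τ ∑_{j < i} a_{ij} (τ G L) G (g v_j)` and
`u' = e ^ (τ G L) u - τ ∑_j b_j (τ G L) G (g v_j)`. -/
structure IsStep {s : ℕ} (tab : Tableau s) (L : H →ₗ.[ℝ] H) (T : ℝ → H →L[ℝ] H) (g : H → H)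
    (τ : ℝ) (u : H) (v : Fin s → H) (u' : H) : Prop where
  stage : ∀ i, v i = T (tab.c i * τ) u -
    τ • ∑ j ∈ Finset.univ.filter (fun j => j < i), (tab.a i j).opG L T τ (g (v j))
  next : u' = T τ u - τ • ∑ j, (tab.b j).opG L T τ (g (v j))

end Operators

/-! ## Gradient flows -/

/-- The data of a gradient flow `u_t = G (𝓛 u + f u) = G (L u - g u)` in a real Hilbert space, where
`L = β I + 𝓛` and `g = β I - f`. The unbounded operator `G` is self-adjoint and negative
(semidefinite), `𝓛` is self-adjoint, `L` is positive definite, and the map `f` is the gradient of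
the functional `F` and is Lipschitz continuous with constant `β`. -/
structure GradientFlow (H : Type*) [NormedAddCommGroup H] [InnerProductSpace ℝ H]
    [CompleteSpace H] where
  G : H →ₗ.[ℝ] H
  calL : H →ₗ.[ℝ] H
  F : H → ℝ
  f : H → H
  β : ℝ
  G_selfAdjoint : IsSelfAdjoint G
  G_nonpos : ∀ x : G.domain, ⟪G x, (x : H)⟫ ≤ 0
  calL_selfAdjoint : IsSelfAdjoint calL
  L_pos : ∃ κ > 0, ∀ x : calL.domain, κ * ‖(x : H)‖ ^ 2 ≤ ⟪β • (x : H) + calL x, (x : H)⟫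
  f_gradient : ∀ u, HasGradientAt F (f u) u
  f_lipschitz : ∀ u v, ‖f u - f v‖ ≤ β * ‖u - v‖

namespace GradientFlow

variable {H : Type*} [NormedAddCommGroup H] [InnerProductSpace ℝ H] [CompleteSpace H]
  (S : GradientFlow H)

/-- The operator `L = β I + 𝓛`, on the domain of `𝓛`. -/
def L : H →ₗ.[ℝ] H := (S.β • (LinearMap.id : H →ₗ[ℝ] H)) +ᵥ S.calL

/-- The nonlinearity `g u = β u - f u`. -/
def g (u : H) : H := S.β • u - S.f u

/-- The operator `G L`, on `{u ∈ D(L) | L u ∈ D(G)}`. -/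
def opGL : H →ₗ.[ℝ] H := opMul S.G S.L

/-- The free energy `E u = (𝓛 u, u) / 2 + F u`, for `u` in the domain of `𝓛`. -/
def energy (u : S.calL.domain) : ℝ := (1 / 2) * ⟪S.calL u, (u : H)⟫ + S.F u

end GradientFlow

/-- The scheme unconditionally decreases the energy: for every gradient flow for which `e ^ (t G L)`
makes sense, every step size `τ > 0` and every `u` of the domain of `𝓛`, one step from `u` stays in
that domain and does not increase the energy. -/
def Tableau.UnconditionallyDecreasesEnergy {s : ℕ} (tab : Tableau s) : Prop :=
  ∀ (H : Type w) [NormedAddCommGroup H] [InnerProductSpace ℝ H] [CompleteSpace H]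
    (S : GradientFlow H) (T : ℝ → H →L[ℝ] H), IsSemigroupOf S.opGL T →
    ∀ τ : ℝ, 0 < τ → ∀ (u : S.calL.domain) (v : Fin s → H) (u' : H),
      IsStep tab S.L T S.g τ (u : H) v u' →
        ∃ hu' : u' ∈ S.calL.domain, S.energy ⟨u', hu'⟩ ≤ S.energy u

end ETDRK

end

namespace ETDRK

/-! Minors. After scaling `z` so that all exponents become integers, each minor times a positive
monomial in `y` and `exp y` is an exponential polynomial `∑ p_k(y) exp(k y)` with integer
coefficients. Its positivity for `y > 0` is a finite check (`expEval_pos`): differentiate `m` times,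
with nonnegative values at `0` along the way, then bound the last derivative below through `exp y ≥
1 + y`. Sylvester's criterion gives definiteness.

Energy. Put `K = L⁻¹`, `q_j = L u - g(v_j)`, and let `x_k` be the increments of the later stages and
of the new value over `u`. Since `f` is `β`-Lipschitz, `F - β/2 ‖·‖²` is concave with gradient `-g`.
With `x_2 = K η`, summing over the stages bounds the energy change by `½⟪K η, η⟫ + ∑ ⟪q_j, x_j -
x_{j-1}⟫`, where `x_{-1} = 0` (`GradientFlow.energy_le_of_stages`). The scheme reads `x = (z P(z))(τ
G L) K q`, so this bound is a quadratic form in `q` with scalar symbol `energyForm (z P(z))`. That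
symbol equals `z/2` times a value of the quadratic form of `Δ'(z)`, hence is nonpositive for `z < 0`
(`Tableau.energyForm_nonpos`).

From scalars to operators, without an unbounded functional calculus (`energyForm_op_nonpos`).
Self-adjointness of `G` and `L` makes `T(t) K` symmetric, so the adjoint `B` of `T(t)` is symmetric
with `0 ≤ B ≤ 1` for the inner product `⟪K x, y⟫`. As `z φ₂(z) = φ₁(z) - 1`, the entries of `z P(z)`
involve only `exp(m z/9)` and `φ₁(m z/9)`; the denominator `9` is common to the nodes `1`, `2/3`,
`4/9`. Riemann sums approximate these functions by polynomials in `exp(z/(9N))` with error `O(1/N)`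
uniformly in `z < 0`. For polynomials in `B`, compression to a finite-dimensional space and
diagonalization reduce the inequality to the scalar one, and then `N → ∞`. -/

/-! ## Positivity of exponential polynomials -/

/-- The value at `y` of the polynomial with the given list of coefficients. -/
def listEval : List ℤ → ℝ → ℝ
  | [], _ => 0
  | a :: p, y => a + y * listEval p y

/-- The sum of two lists of coefficients. -/
def listAdd : List ℤ → List ℤ → List ℤ
  | [], q => q
  | p, [] => p
  | a :: p, b :: q => (a + b) :: listAdd p q

/-- The list of coefficients of `k p`. -/
def listScale (k : ℤ) (p : List ℤ) : List ℤ := p.map (k * ·)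

/-- The list of coefficients of the derivative of `y ^ n * p`, divided by `y ^ (n - 1)`. -/
def listDerivAux : ℤ → List ℤ → List ℤ
  | _, [] => []
  | n, a :: p => (n * a) :: listDerivAux (n + 1) p

/-- The list of coefficients of the derivative. -/
def listDeriv : List ℤ → List ℤ
  | [] => []
  | _ :: p => listDerivAux 1 p

/-- The exponential polynomial `∑ k, p_k(y) * exp(y) ^ k`. -/
noncomputable def expEval : List (List ℤ) → ℝ → ℝ
  | [], _ => 0
  | p :: l, y => listEval p y + Real.exp y * expEval l y

/-- The coefficients of `exp(-k y)` times the derivative of `exp(k y)` times an exponential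
polynomial. -/
def expDeriv : ℤ → List (List ℤ) → List (List ℤ)
  | _, [] => []
  | k, p :: l => listAdd (listScale k p) (listDeriv p) :: expDeriv (k + 1) l

/-- A polynomial lower bound for an exponential polynomial, from `exp y ≥ 1 + y`. -/
def lowerBound : List (List ℤ) → List ℤ
  | [] => []
  | p :: l => listAdd p (listAdd (lowerBound l) (0 :: lowerBound l))

/-- All partial lower bounds have nonnegative coefficients. -/
def lowerBoundNonneg : List (List ℤ) → Bool
  | [] => true
  | p :: l => (lowerBound (p :: l)).all (fun a => decide (0 ≤ a)) && lowerBoundNonneg l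

/-- The value at `0` of an exponential polynomial. -/
def expEvalZero (l : List (List ℤ)) : ℤ := (l.map fun p => p.headD 0).sum

/-- A certificate of positivity on `(0, ∞)`: the first `m` derivatives are nonnegative at `0` and the
lower bound of the `m`-th derivative is positive. -/
def positivityCheck : ℕ → List (List ℤ) → Bool
  | 0, l => decide (0 < (lowerBound l).headD 0) && lowerBoundNonneg l
  | m + 1, l => decide (0 ≤ expEvalZero l) && positivityCheck m (expDeriv 0 l)

theorem listEval_add (p q : List ℤ) (y : ℝ) :
    listEval (listAdd p q) y = listEval p y + listEval q y := by
  induction p generalizing q with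
  | nil => simp [listAdd, listEval]
  | cons a p ih =>
    cases q with
    | nil => simp [listAdd, listEval]
    | cons b q => simp only [listAdd, listEval, ih]; push_cast; ring

theorem listEval_scale (k : ℤ) (p : List ℤ) (y : ℝ) :
    listEval (listScale k p) y = k * listEval p y := by
  induction p with
  | nil => simp [listScale, listEval]
  | cons a p ih =>
    simp only [listScale, List.map_cons, listEval] at ih ⊢
    rw [ih]; push_cast; ring

/-- The factor `y ^ (n + 1)` is the generalization that lets the induction pass to the tail of the
list. -/
theorem hasDerivAt_pow_mul_listEval (p : List ℤ) (n : ℕ) (y : ℝ) :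
    HasDerivAt (fun y => y ^ (n + 1) * listEval p y)
      (y ^ n * listEval (listDerivAux (n + 1 : ℕ) p) y) y := by
  induction p generalizing n with
  | nil => simpa [listEval, listDerivAux] using hasDerivAt_const y (0 : ℝ)
  | cons a p ih =>
    have h := ((hasDerivAt_pow (n + 1) y).mul_const (a : ℝ)).add (ih (n + 1))
    refine (h.congr_deriv ?_).congr_of_eventuallyEq (Eventually.of_forall fun y => ?_)
    · simp only [listEval, listDerivAux, Nat.add_sub_cancel]; push_cast; ring
    · simp only [listEval, Pi.add_apply]; ring

theorem hasDerivAt_listEval (p : List ℤ) (y : ℝ) :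
    HasDerivAt (listEval p) (listEval (listDeriv p) y) y := by
  cases p with
  | nil => exact hasDerivAt_const y (0 : ℝ)
  | cons a p =>
    have h := (hasDerivAt_pow_mul_listEval p 0 y).const_add (a : ℝ)
    simpa [listEval, listDeriv] using h

/-- The weight `exp(k y)` plays the same role here: each step into the tail raises `k` by one. Only
`k = 0` is used afterwards. -/
theorem hasDerivAt_exp_mul_expEval (l : List (List ℤ)) (k : ℕ) (y : ℝ) :
    HasDerivAt (fun y => Real.exp y ^ k * expEval l y)
      (Real.exp y ^ k * expEval (expDeriv k l) y) y := by
  induction l generalizing k with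
  | nil => simpa [expEval, expDeriv] using hasDerivAt_const y (0 : ℝ)
  | cons p l ih =>
    have h := (((Real.hasDerivAt_exp y).pow k).mul (hasDerivAt_listEval p y)).add (ih (k + 1))
    refine (h.congr_deriv ?_).congr_of_eventuallyEq (Eventually.of_forall fun y => ?_)
    · have hk : (k : ℝ) * Real.exp y ^ (k - 1) * Real.exp y = k * Real.exp y ^ k := by
        cases k with
        | zero => simp
        | succ k => simp only [Nat.add_sub_cancel, pow_succ]; ring
      simp only [expEval, expDeriv, listEval_add, listEval_scale]
      push_cast
      rw [hk, Pi.pow_apply]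
      ring
    · simp only [expEval, Pi.add_apply, Pi.mul_apply, Pi.pow_apply]; ring

theorem hasDerivAt_expEval (l : List (List ℤ)) (y : ℝ) :
    HasDerivAt (expEval l) (expEval (expDeriv 0 l) y) y := by
  simpa using hasDerivAt_exp_mul_expEval l 0 y

theorem listEval_nonneg {p : List ℤ} (hp : p.all (fun a => decide (0 ≤ a)) = true) {y : ℝ}
    (hy : 0 ≤ y) : 0 ≤ listEval p y := by
  induction p with
  | nil => exact le_rfl
  | cons a p ih =>
    simp only [List.all_cons, Bool.and_eq_true, decide_eq_true_eq] at hp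
    have : (0 : ℝ) ≤ a := by exact_mod_cast hp.1
    exact add_nonneg this (mul_nonneg hy (ih hp.2))

/-- Horner's scheme in `exp y`, with `exp y` replaced by `1 + y` at each step. The replacement needs
the bound for the remaining tail to be nonnegative, which is why every tail is checked. -/
theorem listEval_lowerBound_le {l : List (List ℤ)} (hl : lowerBoundNonneg l = true) {y : ℝ}
    (hy : 0 ≤ y) : listEval (lowerBound l) y ≤ expEval l y := by
  induction l with
  | nil => exact le_rfl
  | cons p l ih =>
    simp only [lowerBoundNonneg, Bool.and_eq_true] at hl
    have h0 : 0 ≤ listEval (lowerBound l) y := by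
      cases l with
      | nil => exact le_rfl
      | cons q l =>
        have := hl.2
        simp only [lowerBoundNonneg, Bool.and_eq_true] at this
        exact listEval_nonneg this.1 hy
    have h1 := ih hl.2
    have h2 := Real.add_one_le_exp y
    have h3 : (y + 1) * listEval (lowerBound l) y ≤ Real.exp y * expEval l y :=
      mul_le_mul h2 h1 h0 (Real.exp_pos y).le
    simp only [lowerBound, listEval_add, listEval, expEval]
    push_cast
    linarith

theorem headD_le_listEval {p : List ℤ} (hp : p.all (fun a => decide (0 ≤ a)) = true) {y : ℝ}
    (hy : 0 ≤ y) : (p.headD 0 : ℝ) ≤ listEval p y := by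
  cases p with
  | nil => simp [listEval]
  | cons a p =>
    simp only [List.all_cons, Bool.and_eq_true] at hp
    simpa [listEval] using mul_nonneg hy (listEval_nonneg hp.2 hy)

theorem expEval_zero (l : List (List ℤ)) : expEval l 0 = expEvalZero l := by
  induction l with
  | nil => simp [expEval, expEvalZero]
  | cons p l ih =>
    have h : listEval p 0 = (p.headD 0 : ℝ) := by cases p <;> simp [listEval]
    simp only [expEval, expEvalZero, List.map_cons, List.sum_cons] at ih ⊢
    rw [ih, h]
    simp

/-- An exponential polynomial with a certificate of positivity is positive on `(0, ∞)`. -/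
theorem expEval_pos {m : ℕ} {l : List (List ℤ)} (h : positivityCheck m l = true) {y : ℝ}
    (hy : 0 < y) : 0 < expEval l y := by
  induction m generalizing l y with
  | zero =>
    simp only [positivityCheck, Bool.and_eq_true, decide_eq_true_eq] at h
    have h2 : (lowerBound l).all (fun a => decide (0 ≤ a)) = true := by
      cases l with
      | nil => simp [lowerBound]
      | cons q l =>
        have := h.2
        simp only [lowerBoundNonneg, Bool.and_eq_true] at this
        exact this.1
    have h3 : (0 : ℝ) < (lowerBound l).headD 0 := by exact_mod_cast h.1
    exact h3.trans_le ((headD_le_listEval h2 hy.le).trans (listEval_lowerBound_le h.2 hy.le))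
  | succ m ih =>
    simp only [positivityCheck, Bool.and_eq_true, decide_eq_true_eq] at h
    have hmono : StrictMonoOn (expEval l) (Set.Ici 0) := by
      refine strictMonoOn_of_deriv_pos (convex_Ici 0)
        (fun x _ => (hasDerivAt_expEval l x).continuousAt.continuousWithinAt) fun x hx => ?_
      rw [interior_Ici] at hx
      rw [(hasDerivAt_expEval l x).deriv]
      exact ih h.2 hx
    have h0 : (0 : ℝ) ≤ expEval l 0 := by
      rw [expEval_zero]; exact_mod_cast h.1
    exact h0.trans_lt (hmono Set.self_mem_Ici hy.le hy)

/-! ## The two schemes: minors of `Δ'` -/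

theorem Tableau.Delta'_eq (tab : Tableau 3) {z p₁₁ p₂₁ p₂₂ p₃₁ p₃₂ p₃₃ : ℝ}
    (hP : tab.P z = !![p₁₁, 0, 0; p₂₁, p₂₂, 0; p₃₁, p₃₂, p₃₃]) :
    tab.Delta' z =
      !![z * p₁₁ ^ 2 + 2 * p₁₁, z * p₁₁ * (p₂₁ + p₂₂) + p₂₁ + p₁₁,
          z * p₁₁ * (p₃₁ + p₃₂ + p₃₃) + p₃₁ + p₁₁;
        z * p₁₁ * (p₂₁ + p₂₂) + p₂₁ + p₁₁, z * (p₂₁ + p₂₂) ^ 2 + 2 * (p₂₁ + p₂₂),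
          z * (p₂₁ + p₂₂) * (p₃₁ + p₃₂ + p₃₃) + (p₃₁ + p₃₂) + (p₂₁ + p₂₂);
        z * p₁₁ * (p₃₁ + p₃₂ + p₃₃) + p₃₁ + p₁₁,
          z * (p₂₁ + p₂₂) * (p₃₁ + p₃₂ + p₃₃) + (p₃₁ + p₃₂) + (p₂₁ + p₂₂),
          z * (p₃₁ + p₃₂ + p₃₃) ^ 2 + 2 * (p₃₁ + p₃₂ + p₃₃)] := by
  rw [Tableau.Delta', hP]
  ext i j
  fin_cases i <;> fin_cases j <;>
    simp only [Matrix.add_apply, Matrix.smul_apply, Matrix.mul_apply, Fin.sum_univ_three,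
      Matrix.transpose_apply, matE, matEL, Matrix.of_apply] <;> simp <;> ring

theorem phi_one_of_ne {z : ℝ} (hz : z ≠ 0) : phi 1 z = (Real.exp z - 1) / z := by
  simp [phi, hz]

theorem phi_two_of_ne {z : ℝ} (hz : z ≠ 0) : phi 2 z = (phi 1 z - 1) / z := by
  rw [phi]; simp [hz]

theorem EDETDRK3_P (z : ℝ) : EDETDRK3.P z =
    !![phi 1 z, 0, 0;
      2 / 3 * phi 1 (2 / 3 * z) - 4 / 9 * phi 2 (2 / 3 * z), 4 / 9 * phi 2 (2 / 3 * z), 0;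
      3 / 4 * phi 1 z - phi 2 z, phi 2 z - 1 / 2 * phi 1 z, 3 / 4 * phi 1 z] := by
  ext i j
  fin_cases i <;> fin_cases j <;>
    simp [Tableau.P, EDETDRK3, Coeff.eval, PhiTerm.eval, term] <;> ring

theorem EDETDRK3b_P (z : ℝ) : EDETDRK3b.P z =
    !![4 / 9 * phi 1 (4 / 9 * z), 0, 0;
      2 / 3 * phi 1 (2 / 3 * z) - phi 2 (2 / 3 * z), phi 2 (2 / 3 * z), 0;
      phi 1 z - 3 / 2 * phi 2 z, 0, 3 / 2 * phi 2 z] := by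
  ext i j
  fin_cases i <;> fin_cases j <;>
    simp [Tableau.P, EDETDRK3b, Coeff.eval, PhiTerm.eval, term] <;> ring

theorem leadingMinor_pos {A : Matrix (Fin 3) (Fin 3) ℝ} (h1 : 0 < A 0 0)
    (h2 : 0 < A 0 0 * A 1 1 - A 0 1 * A 1 0) (h3 : 0 < A.det) (k : ℕ) (hk : k ≤ 3) :
    0 < (A.submatrix (Fin.castLE hk) (Fin.castLE hk)).det := by
  interval_cases k
  · simp
  · simpa using h1
  · rw [Matrix.det_fin_two]
    exact h2
  · exact h3

/-- Sylvester's criterion for `3 × 3` matrices. -/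
theorem posDef_of_leadingMinor_pos {A : Matrix (Fin 3) (Fin 3) ℝ} (hA : Aᵀ = A) (h1 : 0 < A 0 0)
    (h2 : 0 < A 0 0 * A 1 1 - A 0 1 * A 1 0) (h3 : 0 < A.det) : A.PosDef := by
  have e1 : A 1 0 = A 0 1 := congrFun (congrFun hA 0) 1
  have e2 : A 2 0 = A 0 2 := congrFun (congrFun hA 0) 2
  have e3 : A 2 1 = A 1 2 := congrFun (congrFun hA 1) 2
  refine Matrix.PosDef.of_dotProduct_mulVec_pos (by simpa [Matrix.IsHermitian] using hA) ?_
  intro x hx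
  rw [Matrix.det_fin_three, e1, e2, e3] at h3
  rw [e1] at h2
  simp only [star_trivial, dotProduct, Matrix.mulVec, Fin.sum_univ_three]
  rw [e1, e2, e3]
  set a := A 0 0
  set b := A 0 1
  set c := A 0 2
  set d := A 1 1
  set e := A 1 2
  set f := A 2 2
  -- Completion of squares, cleared of denominators by the product of the first two leading minors;
  -- the last coefficient is the first minor times the determinant.
  have key : (x 0 * (a * x 0 + b * x 1 + c * x 2) + x 1 * (b * x 0 + d * x 1 + e * x 2) +
      x 2 * (c * x 0 + e * x 1 + f * x 2)) * (a * (a * d - b * b)) =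
      (a * d - b * b) * (a * x 0 + b * x 1 + c * x 2) ^ 2 +
        ((a * d - b * b) * x 1 + (a * e - b * c) * x 2) ^ 2 +
        a * (a * d * f - a * e * e - b * b * f + b * e * c + c * b * e - c * d * c) * x 2 ^ 2 := by
    ring
  have hpos : 0 < a * (a * d - b * b) := mul_pos h1 h2
  refine pos_of_mul_pos_left (key ▸ ?_) hpos.le
  -- The last nonzero coordinate of `x` decides which of the three squares is strictly positive.
  by_cases hx2 : x 2 = 0
  · by_cases hx1 : x 1 = 0
    · have hx0 : x 0 ≠ 0 := fun h => hx (by ext i; fin_cases i <;> simpa)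
      have := mul_pos h2 (pow_pos h1 2)
      have := mul_pos this (by positivity : 0 < x 0 ^ 2)
      rw [hx2, hx1]
      nlinarith
    · have : 0 < (a * d - b * b) ^ 2 * x 1 ^ 2 := by positivity
      rw [hx2]
      nlinarith [mul_nonneg h2.le (sq_nonneg (a * x 0 + b * x 1))]
  · have := mul_pos (mul_pos h1 h3) (by positivity : 0 < x 2 ^ 2)
    nlinarith [mul_nonneg h2.le (sq_nonneg (a * x 0 + b * x 1 + c * x 2)),
      sq_nonneg ((a * d - b * b) * x 1 + (a * e - b * c) * x 2)]

theorem exp_neg_nat_mul (n : ℕ) (y : ℝ) : Real.exp (-(n * y)) = (Real.exp y ^ n)⁻¹ := by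
  rw [Real.exp_neg, Real.exp_nat_mul]

theorem EDETDRK3_minors {z : ℝ} (hz : z < 0) :
    0 < EDETDRK3.Delta' z 0 0 ∧
    0 < EDETDRK3.Delta' z 0 0 * EDETDRK3.Delta' z 1 1 -
      EDETDRK3.Delta' z 0 1 * EDETDRK3.Delta' z 1 0 ∧
    0 < (EDETDRK3.Delta' z).det := by
  -- With this scaling `exp z` and `exp (2z/3)` are integer powers of `exp y`.
  obtain ⟨y, hy, rfl⟩ : ∃ y : ℝ, 0 < y ∧ z = -(3 * y) := ⟨-z / 3, by linarith, by ring⟩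
  have hy' : y ≠ 0 := hy.ne'
  have e3 : Real.exp (-(3 * y)) = (Real.exp y ^ 3)⁻¹ := exp_neg_nat_mul 3 y
  have e2 : Real.exp (-(2 * y)) = (Real.exp y ^ 2)⁻¹ := exp_neg_nat_mul 2 y
  have h2 : (2 / 3 * -(3 * y) : ℝ) = -(2 * y) := by ring
  have z3 : -(3 * y) ≠ 0 := by simpa using hy'
  have z2 : -(2 * y) ≠ 0 := by simpa using hy'
  have hb := Real.exp_pos y
  -- The three lists are the numerators of the minors: the outer index is the power of `exp y`, the
  -- inner one the power of `y`. The denominators appear in the `refine` below.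
  have c1 := expEval_pos (m := 1) (l := [[-1], [], [], [], [], [], [1]]) (by decide +kernel) hy
  have c2 := expEval_pos (m := 5) (l := [[0, -6], [0, 0, -9], [0, 6, 6], [-1, 0, -9], [], [2, 2],
    [], [-1, -2, 8]]) (by decide +kernel) hy
  have c3 := expEval_pos (m := 7) (l := [[0, 0, 81], [0, 144, -54], [0, 0, 9], [0, -168, 54],
    [24, -66, 228], [0, -72, -18], [-24, 122, -431], [-48, 76, 210], [0, -24, -135],
    [48, -44, -48], [24, 38], [], [-24, -6, 104]]) (by decide +kernel) hy
  simp only [expEval, listEval] at c1 c2 c3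
  rw [Tableau.Delta'_eq _ (EDETDRK3_P _), h2, phi_two_of_ne z3, phi_two_of_ne z2, phi_one_of_ne z3,
    phi_one_of_ne z2, e3, e2]
  -- The remaining identities are rational in `y` and `exp y`, treated as independent variables.
  generalize Real.exp y = b at *
  have hb' : b ≠ 0 := hb.ne'
  refine ⟨pos_of_mul_pos_left (lt_of_lt_of_eq c1 ?_) (by positivity : 0 ≤ 3 * y * b ^ 6),
    pos_of_mul_pos_left (lt_of_lt_of_eq c2 ?_) (by positivity : 0 ≤ 81 * y ^ 4 * b ^ 7),
    pos_of_mul_pos_left (lt_of_lt_of_eq c3 ?_) (by positivity : 0 ≤ 3888 * y ^ 5 * b ^ 12)⟩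
  · simp
    field_simp
    ring
  · simp
    field_simp
    ring
  · rw [Matrix.det_fin_three]
    simp
    field_simp
    ring

theorem EDETDRK3b_minors {z : ℝ} (hz : z < 0) :
    0 < EDETDRK3b.Delta' z 0 0 ∧
    0 < EDETDRK3b.Delta' z 0 0 * EDETDRK3b.Delta' z 1 1 -
      EDETDRK3b.Delta' z 0 1 * EDETDRK3b.Delta' z 1 0 ∧
    0 < (EDETDRK3b.Delta' z).det := by
  -- The node `4/9` requires the finer scaling by `9`.
  obtain ⟨y, hy, rfl⟩ : ∃ y : ℝ, 0 < y ∧ z = -(9 * y) := ⟨-z / 9, by linarith, by ring⟩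
  have hy' : y ≠ 0 := hy.ne'
  have e9 : Real.exp (-(9 * y)) = (Real.exp y ^ 9)⁻¹ := exp_neg_nat_mul 9 y
  have e6 : Real.exp (-(6 * y)) = (Real.exp y ^ 6)⁻¹ := exp_neg_nat_mul 6 y
  have e4 : Real.exp (-(4 * y)) = (Real.exp y ^ 4)⁻¹ := exp_neg_nat_mul 4 y
  have h6 : (2 / 3 * -(9 * y) : ℝ) = -(6 * y) := by ring
  have h4 : (4 / 9 * -(9 * y) : ℝ) = -(4 * y) := by ring
  have z9 : -(9 * y) ≠ 0 := by simpa using hy'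
  have z6 : -(6 * y) ≠ 0 := by simpa using hy'
  have z4 : -(4 * y) ≠ 0 := by simpa using hy'
  have hb := Real.exp_pos y
  have c1 := expEval_pos (m := 1) (l := [[-1], [], [], [], [], [], [], [], [1]])
    (by decide +kernel) hy
  have c2 := expEval_pos (m := 4) (l := [[0, -8], [], [], [], [-1, 0, -16], [], [0, 8, -16], [],
    [0, 0, -16], [], [2, -4], [], [], [], [], [], [-1, 4, 12]]) (by decide +kernel) hy
  have c3 := expEval_pos (m := 7) (l := [[0, 1], [], [0, -20], [], [0, 4], [], [-2, -6, -36], [],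
    [0, 12, -72], [0, 4, -12], [], [0, 28, -84], [2, -3, -36, -108], [0, -8, 24], [0, 0, -72],
    [4, -24, 108, -216], [], [0, -12, 108, -216], [0, -5, -24, -108], [], [0, -8, 120, -216],
    [-4, 36, -72], [0, 4, -24, -108], [], [-2, 30, -54], [], [], [], [], [], [2, -33, 126]])
    (by decide +kernel) hy
  simp only [expEval, listEval] at c1 c2 c3
  rw [Tableau.Delta'_eq _ (EDETDRK3b_P _), h6, h4, phi_two_of_ne z9, phi_two_of_ne z6,
    phi_one_of_ne z9, phi_one_of_ne z6, phi_one_of_ne z4, e9, e6, e4]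
  generalize Real.exp y = b at *
  have hb' : b ≠ 0 := hb.ne'
  refine ⟨pos_of_mul_pos_left (lt_of_lt_of_eq c1 ?_) (by positivity : 0 ≤ 9 * y * b ^ 8),
    pos_of_mul_pos_left (lt_of_lt_of_eq c2 ?_) (by positivity : 0 ≤ 1296 * y ^ 4 * b ^ 16),
    pos_of_mul_pos_left (lt_of_lt_of_eq c3 ?_) (by positivity : 0 ≤ 104976 * y ^ 6 * b ^ 30)⟩
  · simp
    field_simp
    ring
  · simp
    field_simp
    ring
  · rw [Matrix.det_fin_three]
    simp
    field_simp
    ring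

theorem Tableau.transpose_Delta' {s : ℕ} (tab : Tableau s) (z : ℝ) :
    (tab.Delta' z)ᵀ = tab.Delta' z := by
  have hE : (matE s)ᵀ = matE s := by ext; simp [matE]
  simp only [Tableau.Delta', Matrix.transpose_add, Matrix.transpose_smul, Matrix.transpose_mul,
    Matrix.transpose_transpose, hE, Matrix.mul_assoc]
  abel

/-! ## Polynomials of a symmetric contraction -/

section Galerkin

open Polynomial

variable {V : Type*} [NormedAddCommGroup V] [InnerProductSpace ℝ V]

/-- A finite family of vectors is represented, as far as polynomials of bounded degree of a
symmetric operator `0 ≤ B ≤ 1` are concerned, by functions on a finite subset of `[0, 1]`. -/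
theorem exists_finite_spectral_representation {B : V →ₗ[ℝ] V} (hB : B.IsSymmetric)
    (h0 : ∀ x, 0 ≤ ⟪B x, x⟫) (h1 : ∀ x, ⟪B x, x⟫ ≤ ⟪x, x⟫) {n : ℕ} (q : Fin n → V) (d : ℕ) :
    ∃ (r : ℕ) (μ : Fin r → ℝ) (c : Fin n → Fin r → ℝ), (∀ l, μ l ∈ Set.Icc (0 : ℝ) 1) ∧
      ∀ (p p' : ℝ[X]), p.natDegree ≤ d → p'.natDegree ≤ d → ∀ j k,
        ⟪aeval B p (q j), aeval B p' (q k)⟫ =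
          ∑ l, (p.eval (μ l) * c j l) * (p'.eval (μ l) * c k l) := by
  let v : Fin n × Fin (d + 1) → V := fun i => (B ^ (i.2 : ℕ)) (q i.1)
  let W : Submodule ℝ V := Submodule.span ℝ (Set.range v)
  have : FiniteDimensional ℝ W := FiniteDimensional.span_of_finite ℝ (Set.finite_range v)
  have hmem : ∀ j m, m ≤ d → (B ^ m) (q j) ∈ W := fun j m hm =>
    Submodule.subset_span ⟨(j, ⟨m, by omega⟩), rfl⟩
  -- The compression of `B` to the Krylov space `W`. It agrees with `B` on the vectors `B ^ m (q
  -- j)`, `m < d`, so polynomials of degree at most `d` applied to `q j` are unchanged, while `C`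
  -- can be diagonalized with eigenvalues in `[0, 1]`.
  let C : W →ₗ[ℝ] W := (W.orthogonalProjectionOnto : V →ₗ[ℝ] W) ∘ₗ B ∘ₗ W.subtype
  have hCin : ∀ x y : W, ⟪C x, y⟫ = ⟪B x, (y : V)⟫ := fun x y =>
    W.inner_orthogonalProjectionOnto_eq_of_mem_right y (B x)
  have hC : C.IsSymmetric := fun x y => by
    rw [hCin, real_inner_comm (C y) x, hCin, hB, real_inner_comm]
  have hCB : ∀ x : W, B x ∈ W → (C x : V) = B x := fun x hx =>
    Submodule.starProjection_eq_self_iff.2 hx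
  let q' : Fin n → W := fun j => ⟨q j, by simpa using hmem j 0 (Nat.zero_le _)⟩
  have hpow : ∀ j m, m ≤ d → (((C ^ m) (q' j) : W) : V) = (B ^ m) (q j) := by
    intro j m hm
    induction m with
    | zero => simp [q']
    | succ m ih =>
      have ih := ih (by omega)
      have h := hmem j (m + 1) hm
      rw [pow_succ', Module.End.mul_apply] at h ⊢
      rw [pow_succ', Module.End.mul_apply, hCB, ih]
      rwa [ih]
  have hpoly : ∀ (p : ℝ[X]), p.natDegree ≤ d → ∀ j,
      ((aeval C p (q' j) : W) : V) = aeval B p (q j) := by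
    intro p hp j
    rw [aeval_eq_sum_range, aeval_eq_sum_range, LinearMap.sum_apply, LinearMap.sum_apply,
      Submodule.coe_sum]
    refine Finset.sum_congr rfl fun m hm => ?_
    have : m ≤ d := by
      have := Finset.mem_range.1 hm
      omega
    simp [hpow j m this]
  let b := hC.eigenvectorBasis rfl
  let μ := hC.eigenvalues rfl
  have hrepr : ∀ (p : ℝ[X]) (x : W) l, b.repr (aeval C p x) l = p.eval (μ l) * b.repr x l := by
    intro p x l
    induction p using Polynomial.induction_on' with
    | add p p' hp hp' => simp [hp, hp', add_mul]
    | monomial m a =>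
      have : ∀ m : ℕ, b.repr ((C ^ m) x) l = μ l ^ m * b.repr x l := by
        intro m
        induction m with
        | zero => simp
        | succ m ih =>
          rw [pow_succ', Module.End.mul_apply, hC.eigenvectorBasis_apply_self_apply, ih]
          simp only [pow_succ, μ, RCLike.ofReal_real_eq_id, id]
          ring
      simp [aeval_monomial, this m, mul_assoc]
  refine ⟨_, μ, fun j l => b.repr (q' j) l, fun l => ?_, fun p p' hp hp' j k => ?_⟩
  · have h : ⟪C (b l), b l⟫ = μ l := by
      rw [hC.apply_eigenvectorBasis, inner_smul_left]
      simp [b, μ]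
    have hb : ⟪((b l : W) : V), b l⟫ = 1 := by
      rw [← Submodule.coe_inner]
      simp
    rw [hCin] at h
    refine ⟨h ▸ h0 _, ?_⟩
    rw [← h, ← hb]
    exact h1 _
  · rw [← hpoly p hp, ← hpoly p' hp', ← Submodule.coe_inner, ← b.repr.inner_map_map,
      PiLp.inner_apply]
    refine Finset.sum_congr rfl fun l _ => ?_
    rw [hrepr, hrepr]
    exact mul_comm _ _

/-- The quadratic form `((X c)₃)² / 2 + c₁ (X c)₁ + c₂ ((X c)₂ - (X c)₁) + c₃ ((X c)₃ - (X c)₂)`. -/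
noncomputable def energyForm (X : Matrix (Fin 3) (Fin 3) ℝ) (c : Fin 3 → ℝ) : ℝ :=
  1 / 2 * (X *ᵥ c) 2 ^ 2 + (c 0 * (X *ᵥ c) 0 + c 1 * ((X *ᵥ c) 1 - (X *ᵥ c) 0) +
    c 2 * ((X *ᵥ c) 2 - (X *ᵥ c) 1))

/-- In the finite spectral representation both sides become sums over the eigenvalues, and the
scalar hypothesis is applied to each term. -/
theorem energyForm_aeval_le {B : V →ₗ[ℝ] V} (hB : B.IsSymmetric)
    (h0 : ∀ x, 0 ≤ ⟪B x, x⟫) (h1 : ∀ x, ⟪B x, x⟫ ≤ ⟪x, x⟫) (X : Matrix (Fin 3) (Fin 3) ℝ[X])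
    {ε : ℝ} (hX : ∀ μ ∈ Set.Icc (0 : ℝ) 1, ∀ c : Fin 3 → ℝ,
      energyForm (X.map (eval μ)) c ≤ ε * ∑ j, c j ^ 2) (q : Fin 3 → V) (ξ : Fin 3 → V)
    (hξ : ∀ k, ξ k = ∑ j, aeval B (X k j) (q j)) :
    1 / 2 * ⟪ξ 2, ξ 2⟫ + (⟪q 0, ξ 0⟫ + ⟪q 1, ξ 1 - ξ 0⟫ + ⟪q 2, ξ 2 - ξ 1⟫) ≤
      ε * ∑ j, ⟪q j, q j⟫ := by
  obtain ⟨r, μ, c, hμ, H⟩ := exists_finite_spectral_representation hB h0 h1 q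
    (∑ k, ∑ j, (X k j).natDegree)
  have hdeg : ∀ k j, (X k j).natDegree ≤ ∑ k, ∑ j, (X k j).natDegree := fun k j =>
    (Finset.single_le_sum (f := fun j => (X k j).natDegree) (fun _ _ => Nat.zero_le _)
      (Finset.mem_univ j)).trans
    (Finset.single_le_sum (f := fun k => ∑ j, (X k j).natDegree) (fun _ _ => Nat.zero_le _)
      (Finset.mem_univ k))
  have hqq : ∀ j k, ⟪q j, q k⟫ = ∑ l, c j l * c k l := fun j k => by
    simpa using H 1 1 (by simp) (by simp) j k
  have hqξ : ∀ j k, ⟪q j, ξ k⟫ = ∑ l, c j l * (X.map (eval (μ l)) *ᵥ fun j => c j l) k := by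
    intro j k
    rw [hξ, inner_sum]
    simp only [Matrix.mulVec, dotProduct, Finset.mul_sum]
    rw [Finset.sum_comm]
    refine Finset.sum_congr rfl fun i _ => ?_
    simpa using H 1 (X k i) (by simp) (hdeg k i) j i
  have hξξ : ⟪ξ 2, ξ 2⟫ = ∑ l, (X.map (eval (μ l)) *ᵥ fun j => c j l) 2 ^ 2 := by
    rw [hξ, inner_sum]
    simp only [sum_inner, Matrix.mulVec, dotProduct, sq, Finset.mul_sum, Finset.sum_mul]
    rw [Finset.sum_comm' (t' := Finset.univ) (s' := fun _ => Finset.univ) (by simp)]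
    rw [Finset.sum_comm (s := (Finset.univ : Finset (Fin r)))]
    refine Finset.sum_congr rfl fun i _ => ?_
    rw [Finset.sum_comm]
    refine Finset.sum_congr rfl fun j _ => ?_
    refine (H (X 2 i) (X 2 j) (hdeg 2 i) (hdeg 2 j) i j).trans
      (Finset.sum_congr rfl fun l _ => mul_comm _ _)
  have hsum : 1 / 2 * ⟪ξ 2, ξ 2⟫ + (⟪q 0, ξ 0⟫ + ⟪q 1, ξ 1 - ξ 0⟫ + ⟪q 2, ξ 2 - ξ 1⟫) =
      ∑ l, energyForm (X.map (eval (μ l))) (fun j => c j l) := by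
    simp only [inner_sub_right, hξξ, hqξ, energyForm, Finset.sum_add_distrib, mul_sub,
      Finset.sum_sub_distrib, Finset.mul_sum]
  rw [hsum]
  refine (Finset.sum_le_sum fun l _ => hX _ (hμ l) fun j => c j l).trans (le_of_eq ?_)
  rw [← Finset.mul_sum, Finset.sum_comm]
  congr 1
  refine Finset.sum_congr rfl fun j _ => ?_
  rw [hqq]
  simp [sq]

end Galerkin

/-- The estimate of `energyForm_aeval_le` for an inner product given by its `Core`. -/
theorem energyForm_aeval_le_of_core {V : Type*} [AddCommGroup V] [Module ℝ V]
    (core : InnerProductSpace.Core ℝ V) {B : V →ₗ[ℝ] V}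
    (hB : ∀ x y, core.inner (B x) y = core.inner x (B y))
    (h0 : ∀ x, 0 ≤ core.inner (B x) x) (h1 : ∀ x, core.inner (B x) x ≤ core.inner x x)
    (X : Matrix (Fin 3) (Fin 3) (Polynomial ℝ))
    {ε : ℝ} (hX : ∀ μ ∈ Set.Icc (0 : ℝ) 1, ∀ c : Fin 3 → ℝ,
      energyForm (X.map (Polynomial.eval μ)) c ≤ ε * ∑ j, c j ^ 2) (q : Fin 3 → V) (ξ : Fin 3 → V)
    (hξ : ∀ k, ξ k = ∑ j, Polynomial.aeval B (X k j) (q j)) :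
    1 / 2 * core.inner (ξ 2) (ξ 2) + (core.inner (q 0) (ξ 0) + core.inner (q 1) (ξ 1 - ξ 0) +
      core.inner (q 2) (ξ 2 - ξ 1)) ≤ ε * ∑ j, core.inner (q j) (q j) := by
  -- `V` carries no norm in the statement, so it can be instantiated with `H` under a second inner
  -- product without clashing with the original one.
  let : NormedAddCommGroup V := core.toNormedAddCommGroup
  let : InnerProductSpace ℝ V := InnerProductSpace.ofCore core.toCore
  exact energyForm_aeval_le (B := B) hB h0 h1 X hX q ξ hξ

/-! ## Self-adjoint operators and semigroups -/

section SelfAdjoint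

variable {H : Type*} [NormedAddCommGroup H] [InnerProductSpace ℝ H] [CompleteSpace H]

theorem inner_map_eq_of_isSelfAdjoint {A : H →ₗ.[ℝ] H} (hA : IsSelfAdjoint A) (x y : A.domain) :
    ⟪A x, (y : H)⟫ = ⟪(x : H), A y⟫ := by
  have h := LinearPMap.adjoint_isFormalAdjoint hA.dense_domain
  rw [LinearPMap.isSelfAdjoint_def.1 hA] at h
  exact h x y

/-- Such a `y` lies in the domain of the adjoint, which is `A` itself. -/
theorem exists_apply_eq_of_isSelfAdjoint {A : H →ₗ.[ℝ] H} (hA : IsSelfAdjoint A) {y w : H}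
    (h : ∀ x : A.domain, ⟪w, (x : H)⟫ = ⟪y, A x⟫) : ∃ hy : y ∈ A.domain, A ⟨y, hy⟩ = w := by
  have hmem := LinearPMap.mem_adjoint_domain_of_exists (T := A) y ⟨w, h⟩
  have happ := LinearPMap.adjoint_apply_eq hA.dense_domain ⟨y, hmem⟩ h
  have : (y, w) ∈ (LinearPMap.adjoint A).graph := by
    rw [LinearPMap.mem_graph_iff]
    exact ⟨⟨y, hmem⟩, rfl, happ⟩
  rw [LinearPMap.isSelfAdjoint_def.1 hA, LinearPMap.mem_graph_iff] at this
  obtain ⟨⟨x, hx⟩, rfl, hx'⟩ := this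
  exact ⟨hx, hx'⟩

end SelfAdjoint

/-! ### Strongly continuous semigroups and their generators. -/

section Semigroup

variable {H : Type*} [NormedAddCommGroup H] [InnerProductSpace ℝ H]
  {A : H →ₗ.[ℝ] H} {T : ℝ → H →L[ℝ] H}

namespace IsSemigroupOf

theorem add_apply (hT : IsSemigroupOf A T) {s t : ℝ} (hs : 0 ≤ s) (ht : 0 ≤ t) (x : H) :
    T (s + t) x = T s (T t x) := by rw [hT.add s t hs ht]; rfl

theorem zero_apply (hT : IsSemigroupOf A T) (x : H) : T 0 x = x := by rw [hT.zero]; rfl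

theorem pow_eq (hT : IsSemigroupOf A T) {t : ℝ} (ht : 0 ≤ t) (n : ℕ) : T t ^ n = T (n * t) := by
  induction n with
  | zero => simp [hT.zero]
  | succ n ih =>
    rw [pow_succ, ih, ContinuousLinearMap.mul_def, ← hT.add _ _ (by positivity) ht]
    push_cast
    ring_nf

theorem continuousOn_Icc (hT : IsSemigroupOf A T) (x : H) {a b : ℝ} (ha : 0 ≤ a) :
    ContinuousOn (fun s => T s x) (Set.Icc a b) :=
  (hT.continuousOn x).mono fun _ hs => ha.trans hs.1

theorem map_mem_graph (hT : IsSemigroupOf A T) {x y : H} (h : (x, y) ∈ A.graph) {t : ℝ}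
    (ht : 0 ≤ t) : (T t x, T t y) ∈ A.graph := by
  rw [hT.mem_graph_iff] at h ⊢
  refine (((T t).continuous.tendsto y).comp h).congr' ?_
  filter_upwards [self_mem_nhdsWithin] with s hs
  have hs : (0 : ℝ) ≤ s := le_of_lt hs
  simp only [Function.comp_apply, map_smul, map_sub]
  rw [← hT.add_apply hs ht, ← hT.add_apply ht hs, add_comm]

theorem hasDerivWithinAt_Ici (hT : IsSemigroupOf A T) {x y : H} (h : (x, y) ∈ A.graph) {t : ℝ}
    (ht : 0 ≤ t) : HasDerivWithinAt (fun s => T s x) (T t y) (Set.Ici t) t := by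
  rw [← hasDerivWithinAt_Ioi_iff_Ici, hasDerivWithinAt_iff_tendsto_slope' (by simp)]
  have h' := (hT.mem_graph_iff _ _).1 (hT.map_mem_graph h ht)
  have hsub : Tendsto (fun s => s - t) (𝓝[>] t) (𝓝[>] 0) := by
    refine tendsto_nhdsWithin_iff.2 ⟨?_, ?_⟩
    · have : Tendsto (fun s : ℝ => s - t) (𝓝 t) (𝓝 (t - t)) := (continuous_sub_right t).tendsto t
      rw [sub_self] at this
      exact this.mono_left nhdsWithin_le_nhds
    · filter_upwards [self_mem_nhdsWithin] with s hs
      exact sub_pos.2 (Set.mem_Ioi.1 hs)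
  refine (h'.comp hsub).congr' ?_
  filter_upwards [self_mem_nhdsWithin] with s hs
  have hs : t < s := hs
  simp only [Function.comp_apply, slope_def_module]
  rw [← hT.add_apply (by linarith) ht, sub_add_cancel]

theorem intervalIntegrable (hT : IsSemigroupOf A T) (x : H) {a b : ℝ} (ha : 0 ≤ a) (hab : a ≤ b) :
    IntervalIntegrable (fun s => T s x) MeasureTheory.volume a b :=
  (hT.continuousOn_Icc x ha).intervalIntegrable_of_Icc hab

variable [CompleteSpace H]

theorem exists_norm_le (hT : IsSemigroupOf A T) (t : ℝ) :
    ∃ C, 0 ≤ C ∧ ∀ s ∈ Set.Icc 0 t, ‖T s‖ ≤ C := by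
  obtain ⟨C, hC⟩ := banach_steinhaus (g := fun s : Set.Icc (0 : ℝ) t => T s) fun x => by
    obtain ⟨C, hC⟩ := isCompact_Icc.exists_bound_of_continuousOn
      ((hT.continuousOn x).mono (Set.Icc_subset_Ici_self : Set.Icc (0 : ℝ) t ⊆ _))
    exact ⟨C, fun s => hC s s.2⟩
  exact ⟨max C 0, le_max_right _ _, fun s hs => (hC ⟨s, hs⟩).trans (le_max_left _ _)⟩

theorem integral_eq_sub (hT : IsSemigroupOf A T) {x y : H} (h : (x, y) ∈ A.graph) {a b : ℝ}
    (ha : 0 ≤ a) (hab : a ≤ b) : ∫ s in a..b, T s y = T b x - T a x :=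
  intervalIntegral.integral_eq_sub_of_hasDeriv_right_of_le hab (hT.continuousOn_Icc x ha)
    (fun _ hs => (hT.hasDerivWithinAt_Ici h (ha.trans hs.1.le)).mono Set.Ioi_subset_Ici_self)
    (hT.intervalIntegrable y ha hab)

/-- The generator provides only right derivatives; the two-sided one comes from differentiating the
integral formula `T s x = x + ∫₀ˢ T y`. -/
theorem hasDerivAt (hT : IsSemigroupOf A T) {x y : H} (h : (x, y) ∈ A.graph) {t : ℝ}
    (ht : 0 < t) : HasDerivAt (fun s => T s x) (T t y) t := by
  have hcont : ContinuousAt (fun s => T s y) t :=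
    (hT.continuousOn y).continuousAt (Ici_mem_nhds ht)
  have hmeas : StronglyMeasurableAtFilter (fun s => T s y) (𝓝 t) :=
    ContinuousOn.stronglyMeasurableAtFilter isOpen_Ioi
      ((hT.continuousOn y).mono Set.Ioi_subset_Ici_self) t ht
  have hd := intervalIntegral.integral_hasDerivAt_right (hT.intervalIntegrable y le_rfl ht.le)
    hmeas hcont
  have hd' := hd.add_const x
  refine hd'.congr_of_eventuallyEq ?_
  filter_upwards [Ioi_mem_nhds ht] with s hs
  rw [hT.integral_eq_sub h le_rfl (le_of_lt hs), hT.zero_apply, sub_add_cancel]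

theorem norm_sub_sub_integral_le (hT : IsSemigroupOf A T) {x y : H} (h : (x, y) ∈ A.graph) {t C : ℝ}
    (ht : 0 ≤ t) (hC : ∀ s ∈ Set.Icc 0 t, ‖T s‖ ≤ C) (z : H) :
    ‖T t x - x - ∫ s in (0 : ℝ)..t, T s z‖ ≤ C * ‖y - z‖ * t := by
  have e : T t x - x - ∫ s in (0 : ℝ)..t, T s z = ∫ s in (0 : ℝ)..t, T s (y - z) := by
    simp only [map_sub]
    rw [intervalIntegral.integral_sub (hT.intervalIntegrable y le_rfl ht)
      (hT.intervalIntegrable z le_rfl ht), hT.integral_eq_sub h le_rfl ht, hT.zero_apply]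
  rw [e]
  refine (intervalIntegral.norm_integral_le_of_norm_le_const (C := C * ‖y - z‖)
    fun s hs => ?_).trans (by rw [sub_zero, abs_of_nonneg ht])
  rw [Set.uIoc_of_le ht] at hs
  exact (T s).le_of_opNorm_le (hC s ⟨hs.1.le, hs.2⟩) _

/-- The identity `T t x - x = ∫₀ᵗ T s y ds` survives limits in the graph, by the local bound on `‖T
s‖`; its right derivative at `0` then gives membership. -/
theorem isClosed_graph (hT : IsSemigroupOf A T) : IsClosed (A.graph : Set (H × H)) := by
  refine IsSeqClosed.isClosed fun p a hp hpa => ?_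
  have h1 : Tendsto (fun n => (p n).1) atTop (𝓝 a.1) := (continuous_fst.tendsto a).comp hpa
  have h2 : Tendsto (fun n => (p n).2) atTop (𝓝 a.2) := (continuous_snd.tendsto a).comp hpa
  have key : ∀ t, 0 ≤ t → T t a.1 - a.1 = ∫ s in (0 : ℝ)..t, T s a.2 := by
    intro t ht
    obtain ⟨C, -, hC⟩ := hT.exists_norm_le t
    have hl : Tendsto (fun n => ‖T t (p n).1 - (p n).1 - ∫ s in (0 : ℝ)..t, T s a.2‖) atTop
        (𝓝 ‖T t a.1 - a.1 - ∫ s in (0 : ℝ)..t, T s a.2‖) :=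
      (((((T t).continuous.tendsto _).comp h1).sub h1).sub_const _).norm
    have hr : Tendsto (fun n => C * ‖(p n).2 - a.2‖ * t) atTop (𝓝 (C * ‖a.2 - a.2‖ * t)) :=
      ((h2.sub_const _).norm.const_mul C).mul_const t
    have := le_of_tendsto_of_tendsto' hl hr fun n => hT.norm_sub_sub_integral_le (hp n) ht hC a.2
    rw [sub_self, norm_zero, mul_zero, zero_mul, norm_le_zero_iff, sub_eq_zero] at this
    exact this
  change (a.1, a.2) ∈ A.graph
  rw [hT.mem_graph_iff]
  have hd := intervalIntegral.integral_hasDerivWithinAt_right (s := Set.Ici 0) (t := Set.Ioi 0)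
    (hT.intervalIntegrable a.2 le_rfl (le_refl 0))
    (by
      refine ⟨Set.Ici 0, mem_of_superset self_mem_nhdsWithin Set.Ioi_subset_Ici_self, ?_⟩
      exact (hT.continuousOn a.2).aestronglyMeasurable measurableSet_Ici)
    (((hT.continuousOn a.2).continuousWithinAt Set.self_mem_Ici).mono Set.Ioi_subset_Ici_self)
  rw [← hasDerivWithinAt_Ioi_iff_Ici, hasDerivWithinAt_iff_tendsto_slope' (by simp),
    hT.zero_apply] at hd
  refine hd.congr' ?_
  filter_upwards [self_mem_nhdsWithin] with t ht
  rw [key t (le_of_lt ht), slope_def_module]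
  simp

end IsSemigroupOf

end Semigroup

/-! ## The inverse of `L` and the semigroup of `G L` -/

namespace GradientFlow

variable {H : Type*} [NormedAddCommGroup H] [InnerProductSpace ℝ H] [CompleteSpace H]
  (S : GradientFlow H)

theorem L_apply {x : H} (hx : x ∈ S.L.domain) :
    S.L ⟨x, hx⟩ = S.β • x + S.calL ⟨x, hx⟩ := rfl

theorem inner_L_left (x y : S.L.domain) : ⟪S.L x, (y : H)⟫ = ⟪(x : H), S.L y⟫ := by
  obtain ⟨x, hx⟩ := x
  obtain ⟨y, hy⟩ := y
  rw [L_apply, L_apply, inner_add_left, inner_add_right, inner_smul_left, inner_smul_right,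
    ← inner_map_eq_of_isSelfAdjoint S.calL_selfAdjoint ⟨x, hx⟩ ⟨y, hy⟩]
  rfl

theorem exists_bound_below : ∃ κ > 0, ∀ x : S.L.domain, κ * ‖(x : H)‖ ≤ ‖S.L x‖ := by
  obtain ⟨κ, hκ, h⟩ := S.L_pos
  refine ⟨κ, hκ, fun x => ?_⟩
  have h1 : κ * ‖(x : H)‖ ^ 2 ≤ ‖S.L x‖ * ‖(x : H)‖ :=
    (h x).trans (real_inner_le_norm (S.L x) (x : H))
  rcases (norm_nonneg (x : H)).eq_or_lt with h0 | h0
  · rw [← h0, mul_zero]; exact norm_nonneg _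
  · exact le_of_mul_le_mul_right (by linarith) h0

theorem eq_zero_of_inner_L_eq_zero {x : S.L.domain} (h : ⟪S.L x, (x : H)⟫ = 0) : (x : H) = 0 := by
  obtain ⟨κ, hκ, hx⟩ := S.L_pos
  have h1 : κ * ‖(x : H)‖ ^ 2 ≤ 0 := (hx x).trans_eq h
  have h2 : ‖(x : H)‖ ^ 2 ≤ 0 := by nlinarith [sq_nonneg ‖(x : H)‖]
  exact norm_eq_zero.1 (pow_eq_zero_iff two_ne_zero |>.1 (le_antisymm h2 (sq_nonneg _)))

/-- The range is closed, because `L` is closed and bounded below. A vector orthogonal to it lies in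
the domain by self-adjointness, and positivity makes it zero. -/
theorem L_surjective (w : H) : ∃ x : S.L.domain, S.L x = w := by
  obtain ⟨κ, hκ, hlow⟩ := S.exists_bound_below
  let R : Submodule ℝ H := LinearMap.range S.L.toFun
  have hclosed : IsClosed (R : Set H) := by
    refine IsSeqClosed.isClosed fun y a hy hya => ?_
    choose x hx using hy
    have hcauchy : CauchySeq fun n => ((x n : S.L.domain) : H) := by
      rw [Metric.cauchySeq_iff]
      intro ε hε
      obtain ⟨N, hN⟩ := Metric.cauchySeq_iff.1 hya.cauchySeq (κ * ε) (by positivity)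
      refine ⟨N, fun m hm n hn => ?_⟩
      have h1 := hN m hm n hn
      have h2 := hlow (x m - x n)
      have h3 : S.L (x m - x n) = y m - y n := by
        rw [LinearPMap.map_sub, ← hx m, ← hx n]; rfl
      rw [h3] at h2
      rw [dist_eq_norm] at h1 ⊢
      exact lt_of_mul_lt_mul_left (h2.trans_lt h1) hκ.le
    obtain ⟨b, hb⟩ := cauchySeq_tendsto_of_complete hcauchy
    have hgraph : IsClosed (S.calL.graph : Set (H × H)) := S.calL_selfAdjoint.isClosed
    have hlim : Tendsto (fun n => (((x n : S.L.domain) : H), y n - S.β • ((x n : S.L.domain) : H)))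
        atTop (𝓝 (b, a - S.β • b)) :=
      hb.prodMk_nhds (hya.sub (hb.const_smul _))
    have hmem := hgraph.mem_of_tendsto hlim (Eventually.of_forall fun n => by
      change _ ∈ S.calL.graph
      rw [LinearPMap.mem_graph_iff]
      refine ⟨x n, rfl, ?_⟩
      change S.calL (x n) = y n - S.β • ((x n : S.L.domain) : H)
      rw [← hx n]
      exact (add_sub_cancel_left _ _).symm)
    change _ ∈ S.calL.graph at hmem
    rw [LinearPMap.mem_graph_iff] at hmem
    obtain ⟨z, hz, hz'⟩ := hmem
    refine ⟨z, ?_⟩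
    change S.β • (z : H) + S.calL z = a
    rw [hz', hz]
    exact add_sub_cancel _ _
  have : CompleteSpace R := hclosed.completeSpace_coe
  have htop : R = ⊤ := by
    rw [← Submodule.orthogonal_eq_bot_iff, Submodule.eq_bot_iff]
    intro y hy
    have h0 : ∀ x : S.L.domain, ⟪S.L x, y⟫ = 0 := fun x =>
      (Submodule.mem_orthogonal R y).1 hy _ ⟨x, rfl⟩
    obtain ⟨hy1, hy2⟩ := exists_apply_eq_of_isSelfAdjoint S.calL_selfAdjoint (y := y)
      (w := -(S.β • y)) fun x => by
        have h : ⟪S.β • (x : H) + S.calL x, y⟫ = 0 := h0 x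
        rw [inner_add_left, inner_smul_left] at h
        rw [inner_neg_left, inner_smul_left, real_inner_comm (S.calL x) y, real_inner_comm (x : H) y]
        linarith
    exact S.eq_zero_of_inner_L_eq_zero (x := ⟨y, hy1⟩) (h0 _)
  have : w ∈ R := htop ▸ Submodule.mem_top
  exact this

theorem L_injective {x y : S.L.domain} (h : S.L x = S.L y) : x = y := by
  have h1 : S.L (x - y) = 0 := by rw [LinearPMap.map_sub, h, sub_self]
  have h2 := S.eq_zero_of_inner_L_eq_zero (x := x - y) (by rw [h1, inner_zero_left])
  exact sub_eq_zero.1 (Subtype.ext h2)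

/-- The bounded inverse of `L`. -/
noncomputable def K : H →L[ℝ] H :=
  LinearMap.mkContinuousOfExistsBound
    { toFun := fun w => ((S.L_surjective w).choose : H)
      map_add' := fun w w' => by
        rw [← Submodule.coe_add]
        congr 1
        apply S.L_injective
        rw [LinearPMap.map_add, (S.L_surjective w).choose_spec, (S.L_surjective w').choose_spec,
          (S.L_surjective (w + w')).choose_spec]
      map_smul' := fun r w => by
        rw [RingHom.id_apply, ← Submodule.coe_smul]
        congr 1
        apply S.L_injective
        rw [LinearPMap.map_smul, (S.L_surjective w).choose_spec,
          (S.L_surjective (r • w)).choose_spec] }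
    (by
      obtain ⟨κ, hκ, h⟩ := S.exists_bound_below
      refine ⟨κ⁻¹, fun w => ?_⟩
      have := h (S.L_surjective w).choose
      rw [(S.L_surjective w).choose_spec] at this
      rw [inv_mul_eq_div, le_div_iff₀ hκ, mul_comm]
      exact this)

theorem K_mem (w : H) : S.K w ∈ S.L.domain := (S.L_surjective w).choose.2

theorem L_K (w : H) : S.L ⟨S.K w, S.K_mem w⟩ = w := (S.L_surjective w).choose_spec

theorem K_L (x : S.L.domain) : S.K (S.L x) = x :=
  congrArg Subtype.val (S.L_injective (S.L_K (S.L x)))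

theorem opInv_L (w : H) : opInv S.L w = S.K w := by
  rw [opInv, dif_pos (S.L_surjective w)]
  rfl

theorem inner_K_left (x y : H) : ⟪S.K x, y⟫ = ⟪x, S.K y⟫ := by
  have h := S.inner_L_left ⟨S.K x, S.K_mem x⟩ ⟨S.K y, S.K_mem y⟩
  rw [L_K, L_K] at h
  exact h.symm

theorem inner_K_self_nonneg (x : H) : 0 ≤ ⟪S.K x, x⟫ := by
  obtain ⟨κ, hκ, h⟩ := S.L_pos
  have h1 : κ * ‖S.K x‖ ^ 2 ≤ ⟪S.L ⟨S.K x, S.K_mem x⟩, S.K x⟫ := h ⟨S.K x, S.K_mem x⟩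
  rw [L_K, real_inner_comm] at h1
  exact le_trans (by positivity) h1

theorem eq_zero_of_inner_K_self {x : H} (h : ⟪S.K x, x⟫ = 0) : x = 0 := by
  have h1 : S.K x = 0 := S.eq_zero_of_inner_L_eq_zero (x := ⟨S.K x, S.K_mem x⟩) (by
    rw [L_K, real_inner_comm]; exact h)
  rw [← S.L_K x]
  have : (⟨S.K x, S.K_mem x⟩ : S.L.domain) = 0 := Subtype.ext h1
  rw [this, LinearPMap.map_zero]

/-- The inner product `(K x, y)`. -/
@[reducible]
noncomputable def innerCore : InnerProductSpace.Core ℝ H where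
  inner x y := ⟪S.K x, y⟫
  conj_inner_symm x y := by rw [conj_trivial, inner_K_left, real_inner_comm]
  re_inner_nonneg x := S.inner_K_self_nonneg x
  add_left x y z := by rw [map_add, inner_add_left]
  smul_left x y r := by rw [map_smul, inner_smul_left]
  definite _ := S.eq_zero_of_inner_K_self

theorem mem_graph_opGL {x y : H} :
    (x, y) ∈ S.opGL.graph ↔ ∃ w : S.G.domain, S.K w = x ∧ S.G w = y := by
  rw [LinearPMap.mem_graph_iff]
  constructor
  · rintro ⟨⟨x', hx⟩, rfl, rfl⟩
    exact ⟨⟨_, hx.choose_spec⟩, S.K_L _, rfl⟩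
  · rintro ⟨w, rfl, rfl⟩
    have h : S.L ⟨S.K w, S.K_mem w⟩ ∈ S.G.domain := by rw [L_K]; exact w.2
    refine ⟨⟨S.K w, S.K_mem w, h⟩, rfl, ?_⟩
    change S.G ⟨S.L ⟨S.K w, S.K_mem w⟩, h⟩ = S.G w
    congr 1
    exact Subtype.ext (S.L_K _)

theorem inner_G_left (x y : S.G.domain) : ⟪S.G x, (y : H)⟫ = ⟪(x : H), S.G y⟫ :=
  inner_map_eq_of_isSelfAdjoint S.G_selfAdjoint x y

variable {S} {T : ℝ → H →L[ℝ] H}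

/-- For `x = K w` in the domain of `G L`, the vector `L T(t) x` depends continuously on `t`. -/
theorem exists_continuousOn_L_semigroup (hT : IsSemigroupOf S.opGL T) (w : S.G.domain) :
    ∃ ℓ : ℝ → S.G.domain, ContinuousOn (fun t => (ℓ t : H)) (Set.Ici 0) ∧
      ∀ t, 0 ≤ t → S.K (ℓ t) = T t (S.K w) ∧ S.G (ℓ t) = T t (S.G w) := by
  have : CompleteSpace S.opGL.graph := hT.isClosed_graph.completeSpace_coe
  have hmem : ∀ p : S.opGL.graph, (p : H × H).1 ∈ S.L.domain := fun p => by
    obtain ⟨v, hv, -⟩ := S.mem_graph_opGL.1 p.2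
    exact hv ▸ S.K_mem v
  let Λ : S.opGL.graph →ₗ[ℝ] H := S.L.toFun ∘ₗ
    LinearMap.codRestrict S.L.domain (LinearMap.fst ℝ H H ∘ₗ S.opGL.graph.subtype) hmem
  have hKΛ : ∀ p, S.K (Λ p) = (p : H × H).1 := fun p => S.K_L ⟨_, hmem p⟩
  have hΛ : Continuous Λ := by
    -- Closed graph theorem: `K` is bounded and injective, so a limit of `Λ (u n)` is determined by
    -- its image under `K`.
    refine Λ.continuous_of_seq_closed_graph fun u x y hu hy => ?_
    have h1 : Tendsto (fun n => ((u n : S.opGL.graph) : H × H).1) atTop (𝓝 (x : H × H).1) :=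
      ((continuous_fst.comp continuous_subtype_val).tendsto x).comp hu
    have h2 : Tendsto (fun n => S.K (Λ (u n))) atTop (𝓝 (S.K y)) := (S.K.continuous.tendsto y).comp hy
    simp only [hKΛ] at h2
    have h3 : S.K y = S.K (Λ x) := by rw [hKΛ]; exact tendsto_nhds_unique h2 h1
    have h4 := S.L_K y
    have h5 := S.L_K (Λ x)
    have h6 : (⟨S.K y, S.K_mem y⟩ : S.L.domain) = ⟨S.K (Λ x), S.K_mem (Λ x)⟩ := Subtype.ext h3
    rw [← h4, h6, h5]
  have hw : (S.K w, S.G w) ∈ S.opGL.graph := S.mem_graph_opGL.2 ⟨w, rfl, rfl⟩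
  have hgr : ∀ t : ℝ, ∃ v : S.G.domain, 0 ≤ t → S.K v = T t (S.K w) ∧ S.G v = T t (S.G w) := by
    intro t
    by_cases ht : 0 ≤ t
    · obtain ⟨v, hv⟩ := S.mem_graph_opGL.1 (hT.map_mem_graph hw ht)
      exact ⟨v, fun _ => hv⟩
    · exact ⟨0, fun h => absurd h ht⟩
  choose ℓ hℓ using hgr
  refine ⟨ℓ, ?_, hℓ⟩
  rw [continuousOn_iff_continuous_domRestrict]
  let γ : Set.Ici (0 : ℝ) → S.opGL.graph := fun t =>
    ⟨(T t (S.K w), T t (S.G w)), hT.map_mem_graph hw t.2⟩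
  have hγ : Continuous γ := by
    refine Continuous.subtype_mk (Continuous.prodMk ?_ ?_) _
    · exact continuousOn_iff_continuous_domRestrict.1 (hT.continuousOn (S.K w))
    · exact continuousOn_iff_continuous_domRestrict.1 (hT.continuousOn (S.G w))
  refine (hΛ.comp hγ).congr fun t => ?_
  have h1 : S.K (Λ (γ t)) = S.K (ℓ t) := by rw [hKΛ, (hℓ t t.2).1]
  have h6 : (⟨S.K (Λ (γ t)), S.K_mem _⟩ : S.L.domain) = ⟨S.K (ℓ t), S.K_mem _⟩ := Subtype.ext h1
  have h7 := S.L_K (Λ (γ t))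
  rw [h6, S.L_K] at h7
  exact h7.symm

/-! ### Symmetry, positivity and contractivity of the semigroup relative to `K`. -/

/-- The function `s ↦ ⟪L T(s) K w, T(t - s) K w'⟫` is constant: symmetry of `G` cancels the two
terms of its derivative. Its values at `0` and `t` are the two sides. -/
theorem inner_semigroup_K_of_mem (hT : IsSemigroupOf S.opGL T) {t : ℝ} (ht : 0 ≤ t)
    (w w' : S.G.domain) : ⟪T t (S.K w), (w' : H)⟫ = ⟪(w : H), T t (S.K w')⟫ := by
  obtain ⟨ℓ, hℓc, hℓ⟩ := exists_continuousOn_L_semigroup hT w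
  obtain ⟨m, -, hm⟩ := exists_continuousOn_L_semigroup hT w'
  have hw : (S.K w, S.G w) ∈ S.opGL.graph := S.mem_graph_opGL.2 ⟨w, rfl, rfl⟩
  have hw' : (S.K w', S.G w') ∈ S.opGL.graph := S.mem_graph_opGL.2 ⟨w', rfl, rfl⟩
  have hsub : Set.MapsTo (fun s => t - s) (Set.Icc 0 t) (Set.Ici 0) := fun s hs => by
    simpa using hs.2
  have hycont : ContinuousOn (fun s => T (t - s) (S.K w')) (Set.Icc 0 t) :=
    (hT.continuousOn (S.K w')).comp (by fun_prop) hsub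
  have hconst := constant_of_has_deriv_right_zero (f := fun s => ⟪(ℓ s : H), T (t - s) (S.K w')⟫)
    (a := 0) (b := t) ((hℓc.mono Set.Icc_subset_Ici_self).inner hycont) ?_ t ⟨ht, le_rfl⟩
  · have e0 : ∀ v v' : S.G.domain, S.K v = S.K v' → (v : H) = v' := fun v v' h => by
      have h6 : (⟨S.K v, S.K_mem _⟩ : S.L.domain) = ⟨S.K v', S.K_mem _⟩ := Subtype.ext h
      rw [← S.L_K v, h6, S.L_K]
    have h0 : (ℓ 0 : H) = w := e0 _ _ (by rw [(hℓ 0 le_rfl).1, hT.zero_apply])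
    simp only [sub_self, sub_zero, hT.zero_apply, h0] at hconst
    rw [← hconst, ← (hℓ t ht).1, S.inner_K_left]
  · intro s hs
    have hts : 0 < t - s := sub_pos.2 hs.2
    have hd1 : HasDerivWithinAt (fun s' => ⟪T s' (S.K w), (m (t - s) : H)⟫)
        ⟪T s (S.G w), (m (t - s) : H)⟫ (Set.Ici s) s := by
      have h := (hT.hasDerivWithinAt_Ici hw hs.1).inner ℝ
        (hasDerivWithinAt_const s (Set.Ici s) (m (t - s) : H))
      simpa using h
    -- The curve `ℓ` is only known to be continuous. That suffices here, because the other factor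
    -- vanishes at `s`; the remaining summand is rewritten through `K` so that only `T s' (K w)` is
    -- differentiated.
    have hd2 : HasDerivWithinAt
        (fun s' => ⟪(ℓ s' : H), T (t - s') (S.K w') - T (t - s) (S.K w')⟫)
        ⟪(ℓ s : H), -T (t - s) (S.G w')⟫ (Set.Ici s) s := by
      have hy : HasDerivAt (fun s' => T (t - s') (S.K w')) (-T (t - s) (S.G w')) s := by
        have h := (hT.hasDerivAt hw' hts).scomp s ((hasDerivAt_id s).const_sub t)
        simpa [Function.comp_def] using h
      have hy' := (hy.hasDerivWithinAt (s := Set.Ici s))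
      rw [← hasDerivWithinAt_Ioi_iff_Ici, hasDerivWithinAt_iff_tendsto_slope' (by simp)] at hy' ⊢
      have hc : Tendsto (fun s' => (ℓ s' : H)) (𝓝[>] s) (𝓝 (ℓ s : H)) :=
        (hℓc s hs.1).mono_left (nhdsWithin_mono _ fun x hx => hs.1.trans (le_of_lt hx))
      refine (hc.inner hy').congr fun s' => ?_
      simp only [slope_def_module, sub_self, inner_zero_right, sub_zero, smul_eq_mul,
        inner_smul_right]
    have hsum := hd2.add hd1
    have hzero : ⟪(ℓ s : H), -T (t - s) (S.G w')⟫ + ⟪T s (S.G w), (m (t - s) : H)⟫ = 0 := by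
      rw [← (hm _ hts.le).2, ← (hℓ s hs.1).2, inner_neg_right, S.inner_G_left]
      ring
    rw [hzero] at hsum
    refine hsum.congr_of_mem (fun s' hs' => ?_) Set.self_mem_Ici
    have hs0 : 0 ≤ s' := hs.1.trans hs'
    change _ = ⟪(ℓ s' : H), T (t - s') (S.K w') - T (t - s) (S.K w')⟫ +
      ⟪T s' (S.K w), (m (t - s) : H)⟫
    rw [← (hℓ s' hs0).1, S.inner_K_left, (hm _ hts.le).1, ← inner_add_right, sub_add_cancel]

/-- `T(t) K` is self-adjoint. -/
theorem inner_semigroup_K (hT : IsSemigroupOf S.opGL T) {t : ℝ} (ht : 0 ≤ t) (w w' : H) :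
    ⟪T t (S.K w), w'⟫ = ⟪w, T t (S.K w')⟫ := by
  have hdense : Dense (S.G.domain : Set H) := S.G_selfAdjoint.dense_domain
  have h1 : ∀ w ∈ S.G.domain, ∀ w', ⟪T t (S.K w), w'⟫ = ⟪w, T t (S.K w')⟫ := by
    intro w hw w'
    refine congrFun (Continuous.ext_on (f := fun w' => ⟪T t (S.K w), w'⟫)
      (g := fun w' => ⟪w, T t (S.K w')⟫) hdense (by fun_prop) (by fun_prop) fun w' hw' => ?_) w'
    exact inner_semigroup_K_of_mem hT ht ⟨w, hw⟩ ⟨w', hw'⟩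
  exact congrFun (Continuous.ext_on (f := fun w => ⟪T t (S.K w), w'⟫)
    (g := fun w => ⟪w, T t (S.K w')⟫) hdense (by fun_prop) (by fun_prop) fun w hw => h1 w hw w') w

/-- This intertwining shows that `T t` preserves the range of `K`, which is the domain of `L`. -/
theorem semigroup_K_eq (hT : IsSemigroupOf S.opGL T) {t : ℝ} (ht : 0 ≤ t) (w : H) :
    T t (S.K w) = S.K (ContinuousLinearMap.adjoint (T t) w) := by
  refine ext_inner_right ℝ fun v => ?_
  rw [inner_semigroup_K hT ht, S.inner_K_left, ContinuousLinearMap.adjoint_inner_left]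

/-- Splitting `t` in halves turns the form into `⟪K y, y⟫` with `y` the adjoint of `T (t/2)` applied
to `w`. -/
theorem inner_semigroup_K_self_nonneg (hT : IsSemigroupOf S.opGL T) {t : ℝ} (ht : 0 ≤ t) (w : H) :
    0 ≤ ⟪T t (S.K w), w⟫ := by
  have h2 : 0 ≤ t / 2 := by positivity
  rw [← add_halves t, hT.add_apply h2 h2, ← ContinuousLinearMap.adjoint_inner_right,
    semigroup_K_eq hT h2]
  exact S.inner_K_self_nonneg _

/-- For `w` in the domain of `G`, the derivative of `⟪T s (K w), w⟫` is `⟪G v, v⟫ ≤ 0` with `v` the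
adjoint of `T (s/2)` applied to `w`; density does the rest. -/
theorem inner_semigroup_K_self_le (hT : IsSemigroupOf S.opGL T) {t : ℝ} (ht : 0 ≤ t) (w : H) :
    ⟪T t (S.K w), w⟫ ≤ ⟪S.K w, w⟫ := by
  have hdense : Dense (S.G.domain : Set H) := S.G_selfAdjoint.dense_domain
  have hclosed : IsClosed {w : H | ⟪T t (S.K w), w⟫ ≤ ⟪S.K w, w⟫} :=
    isClosed_le (by fun_prop) (by fun_prop)
  refine (hclosed.closure_subset_iff.2 fun w hw => ?_) (hdense w)
  have hgr : (S.K w, S.G ⟨w, hw⟩) ∈ S.opGL.graph := S.mem_graph_opGL.2 ⟨⟨w, hw⟩, rfl, rfl⟩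
  have hneg : ∀ s, 0 ≤ s → ⟪T s (S.G ⟨w, hw⟩), w⟫ ≤ 0 := by
    intro s hs
    have h2 : 0 ≤ s / 2 := by positivity
    obtain ⟨v, hv1, hv2⟩ := S.mem_graph_opGL.1 (hT.map_mem_graph hgr h2)
    have hv : (v : H) = ContinuousLinearMap.adjoint (T (s / 2)) w := by
      rw [semigroup_K_eq hT h2] at hv1
      refine sub_eq_zero.1 (S.eq_zero_of_inner_K_self ?_)
      rw [map_sub, hv1, sub_self, inner_zero_left]
    rw [← add_halves s, hT.add_apply h2 h2, ← hv2, ← ContinuousLinearMap.adjoint_inner_right, ← hv]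
    exact S.G_nonpos v
  have key := image_le_of_deriv_right_le_deriv_boundary (f := fun s => ⟪T s (S.K w), w⟫)
    (f' := fun s => ⟪T s (S.G ⟨w, hw⟩), w⟫) (B := fun _ => ⟪S.K w, w⟫) (B' := fun _ => 0)
    (a := 0) (b := t) ((hT.continuousOn_Icc _ le_rfl).inner continuousOn_const)
    (fun s hs => by
      have h := (hT.hasDerivWithinAt_Ici hgr hs.1).inner ℝ (hasDerivWithinAt_const s (Set.Ici s) w)
      simpa using h)
    (by simp [hT.zero_apply]) continuousOn_const (fun s _ => hasDerivWithinAt_const _ _ _)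
    (fun s hs => hneg s hs.1)
  exact key ⟨ht, le_rfl⟩

end GradientFlow

/-! ## Functions of `G L` -/

theorem tendsto_riemann_sum {f : ℝ → ℝ} (hf : ContinuousOn f (Set.Icc 0 1)) :
    Tendsto (fun N : ℕ => (N : ℝ)⁻¹ * ∑ i ∈ Finset.range N, f (i / N)) atTop
      (𝓝 (∫ θ in (0 : ℝ)..1, f θ)) := by
  have huc := isCompact_Icc.uniformContinuousOn_of_continuous hf
  rw [Metric.uniformContinuousOn_iff_le] at huc
  rw [Metric.tendsto_atTop']
  intro ε hε
  obtain ⟨δ, hδ, h⟩ := huc (ε / 2) (by positivity)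
  obtain ⟨M, hM⟩ := exists_nat_gt δ⁻¹
  refine ⟨M, fun N hN => ?_⟩
  have hN0 : (0 : ℝ) < N := lt_of_lt_of_le (inv_pos.2 hδ |>.trans hM) (by exact_mod_cast hN.le)
  have hNδ : (N : ℝ)⁻¹ ≤ δ := by
    rw [inv_le_comm₀ hN0 hδ]
    exact hM.le.trans (by exact_mod_cast hN.le)
  have hint : ∀ i < N, IntervalIntegrable f MeasureTheory.volume (i / N : ℝ) ((i + 1 : ℕ) / N : ℝ) := by
    intro i hi
    refine (hf.mono ?_).intervalIntegrable_of_Icc (by gcongr; simp)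
    refine Set.Icc_subset_Icc (by positivity) ?_
    rw [div_le_one hN0]
    exact_mod_cast hi
  have hsum := intervalIntegral.sum_integral_adjacent_intervals (a := fun i : ℕ => (i / N : ℝ))
    (n := N) hint
  simp only [Nat.cast_zero, zero_div, div_self hN0.ne'] at hsum
  rw [← hsum, dist_eq_norm, Finset.mul_sum, ← Finset.sum_sub_distrib]
  have hterm : ∀ i ∈ Finset.range N, ‖(N : ℝ)⁻¹ * f (i / N) -
      ∫ θ in (i / N : ℝ)..((i + 1 : ℕ) / N : ℝ), f θ‖ ≤ ε / 2 * (N : ℝ)⁻¹ := by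
    intro i hi
    have hi := Finset.mem_range.1 hi
    have hlen : ((i + 1 : ℕ) / N : ℝ) - i / N = (N : ℝ)⁻¹ := by push_cast; ring
    have hle : (i / N : ℝ) ≤ (i + 1 : ℕ) / N := by gcongr; simp
    have h1 : ((i + 1 : ℕ) / N : ℝ) ≤ 1 := by
      rw [div_le_one hN0]; exact_mod_cast hi
    have e : (N : ℝ)⁻¹ * f (i / N) = ∫ θ in (i / N : ℝ)..((i + 1 : ℕ) / N : ℝ), f (i / N) := by
      rw [intervalIntegral.integral_const, hlen, smul_eq_mul]
    rw [e, ← intervalIntegral.integral_sub (by simp) (hint i hi)]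
    refine (intervalIntegral.norm_integral_le_of_norm_le_const (C := ε / 2)
      fun θ hθ => ?_).trans_eq ?_
    · rw [Set.uIoc_of_le hle] at hθ
      have h0 : (0 : ℝ) ≤ i / N := by positivity
      have := h (i / N) ⟨h0, hle.trans h1⟩ θ ⟨h0.trans hθ.1.le, hθ.2.trans h1⟩ (by
        rw [dist_comm, Real.dist_eq, abs_of_nonneg (by linarith [hθ.1])]
        linarith [hθ.2])
      rwa [dist_eq_norm] at this
    · rw [hlen, abs_of_pos (inv_pos.2 hN0)]
  refine (norm_sum_le_of_le _ hterm).trans_lt ?_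
  rw [Finset.sum_const, Finset.card_range, nsmul_eq_mul]
  rw [mul_comm (ε / 2), ← mul_assoc, mul_inv_cancel₀ hN0.ne']
  linarith

/-- The functions `exp(m z / 9)` and `φ₁(m z / 9)`, as symbols. -/
inductive Symb
  | exp (m : ℕ)
  | avg (m : ℕ)

namespace Symb

/-- The value at a real number. -/
noncomputable def val : Symb → ℝ → ℝ
  | exp m, z => Real.exp (m / 9 * z)
  | avg m, z => phi 1 (m / 9 * z)

/-- The value at the operator `τ G L`, for `T t = e ^ (t G L)`. -/
noncomputable def op {H : Type*} [NormedAddCommGroup H] [InnerProductSpace ℝ H]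
    (T : ℝ → H →L[ℝ] H) (τ : ℝ) : Symb → H → H
  | exp m, x => T (m / 9 * τ) x
  | avg m, x => phiOp T 1 (m / 9 * τ) x

/-- An approximation by a polynomial of `exp(z / (9 N))`. -/
noncomputable def poly (N : ℕ) : Symb → Polynomial ℝ
  | exp m => Polynomial.X ^ (m * N)
  | avg m => Polynomial.C (N : ℝ)⁻¹ * ∑ i ∈ Finset.range N, Polynomial.X ^ (m * i)

/-- With `s = -z / N` and `a = exp(-s)`, summing the geometric series gives the error `N⁻¹ (1 - a ^
N) (1/(1 - a) - 1/s)`. The last bracket lies in `[0, 1]` because `1 - a ≤ s` and `a (1 + s) ≤ 1`. -/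
theorem abs_riemann_sum_exp_sub_le {z : ℝ} (hz : z < 0) {N : ℕ} (hN : 0 < N) :
    |(N : ℝ)⁻¹ * ∑ i ∈ Finset.range N, Real.exp (z / N) ^ i - (Real.exp z - 1) / z| ≤ (N : ℝ)⁻¹ := by
  have hN0 : (0 : ℝ) < N := by exact_mod_cast hN
  obtain ⟨s, hs, rfl⟩ : ∃ s : ℝ, 0 < s ∧ z = -(s * N) :=
    ⟨-z / N, div_pos (neg_pos.2 hz) hN0, by field_simp⟩
  have e1 : -(s * N) / N = -s := by field_simp
  have e2 : Real.exp (-(s * N)) = Real.exp (-s) ^ N := by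
    rw [← Real.exp_nat_mul]; congr 1; ring
  have ha0 := Real.exp_pos (-s)
  have ha1 : Real.exp (-s) < 1 := Real.exp_lt_one_iff.2 (by linarith)
  have hle1 : 1 - Real.exp (-s) ≤ s := by linarith [Real.add_one_le_exp (-s)]
  have hle2 : Real.exp (-s) * (1 + s) ≤ 1 := by
    have := Real.add_one_le_exp s
    calc Real.exp (-s) * (1 + s) ≤ Real.exp (-s) * Real.exp s := by gcongr; linarith
      _ = 1 := by rw [← Real.exp_add]; simp
  rw [e1, e2, geom_sum_eq ha1.ne]
  set a := Real.exp (-s)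
  have hpow0 : 0 ≤ 1 - a ^ N := by linarith [pow_le_one₀ (n := N) ha0.le ha1.le]
  have hpow1 : 1 - a ^ N ≤ 1 := by linarith [pow_pos ha0 N]
  have e3 : (N : ℝ)⁻¹ * ((a ^ N - 1) / (a - 1)) - (a ^ N - 1) / -(s * N) =
      (N : ℝ)⁻¹ * ((1 - a ^ N) * ((s - (1 - a)) / ((1 - a) * s))) := by
    have : a - 1 ≠ 0 := by linarith
    have : 1 - a ≠ 0 := by linarith
    field_simp
    ring
  have h1a : 0 < 1 - a := by linarith
  have hq0 : 0 ≤ (s - (1 - a)) / ((1 - a) * s) := div_nonneg (by linarith) (by positivity)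
  have hq1 : (s - (1 - a)) / ((1 - a) * s) ≤ 1 := by
    rw [div_le_one (by positivity)]; nlinarith
  rw [e3, abs_of_nonneg (by positivity)]
  have : (1 - a ^ N) * ((s - (1 - a)) / ((1 - a) * s)) ≤ 1 := mul_le_one₀ hpow1 hq0 hq1
  exact mul_le_of_le_one_right (by positivity) this

theorem abs_eval_poly_sub_le (σ : Symb) {z : ℝ} (hz : z < 0) {N : ℕ} (hN : 0 < N) :
    |(σ.poly N).eval (Real.exp (z / (9 * N))) - σ.val z| ≤ (N : ℝ)⁻¹ := by
  have hN0 : (0 : ℝ) < N := by exact_mod_cast hN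
  cases σ with
  | exp m =>
    have : Real.exp (z / (9 * N)) ^ (m * N) = Real.exp (m / 9 * z) := by
      rw [← Real.exp_nat_mul]; congr 1; push_cast; field_simp
    simp only [poly, val, Polynomial.eval_pow, Polynomial.eval_X, this, sub_self, abs_zero]
    positivity
  | avg m =>
    simp only [poly, val, Polynomial.eval_mul, Polynomial.eval_C, Polynomial.eval_finsetSum,
      Polynomial.eval_pow, Polynomial.eval_X, pow_mul]
    have : Real.exp (z / (9 * N)) ^ m = Real.exp (m / 9 * z / N) := by
      rw [← Real.exp_nat_mul]; congr 1; field_simp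
    rw [this]
    rcases Nat.eq_zero_or_pos m with rfl | hm
    · simp [phi, hN0.ne']
    · have hmz : (m / 9 * z : ℝ) < 0 := mul_neg_of_pos_of_neg (by positivity) hz
      rw [phi_one_of_ne hmz.ne]
      exact abs_riemann_sum_exp_sub_le hmz hN

theorem abs_val_le (σ : Symb) {z : ℝ} (hz : z < 0) : |σ.val z| ≤ 1 := by
  cases σ with
  | exp m =>
    rw [val, abs_of_pos (Real.exp_pos _)]
    exact Real.exp_le_one_iff.2 (mul_nonpos_of_nonneg_of_nonpos (by positivity) hz.le)
  | avg m =>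
    rw [val]
    rcases Nat.eq_zero_or_pos m with rfl | hm
    · simp [phi]
    · have hmz : (m / 9 * z : ℝ) < 0 := mul_neg_of_pos_of_neg (by positivity) hz
      rw [phi_one_of_ne hmz.ne, ← neg_div_neg_eq, abs_of_nonneg, div_le_one (by linarith)]
      · linarith [Real.add_one_le_exp (m / 9 * z : ℝ)]
      · exact div_nonneg (by linarith [Real.exp_le_one_iff.2 hmz.le]) (by linarith)

end Symb

section Operators

variable {H : Type*} [NormedAddCommGroup H] [InnerProductSpace ℝ H]

theorem phiOp_one_eq (T : ℝ → H →L[ℝ] H) (t : ℝ) (x : H) :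
    phiOp T 1 t x = ∫ θ in (0 : ℝ)..1, T (θ * t) x := by
  have := intervalIntegral.integral_comp_sub_left (a := 0) (b := 1) (fun θ => T (θ * t) x) (1 : ℝ)
  simpa [phiOp] using this

theorem IsSemigroupOf.continuousOn_mul {A : H →ₗ.[ℝ] H} {T : ℝ → H →L[ℝ] H}
    (hT : IsSemigroupOf A T) {t : ℝ} (ht : 0 ≤ t) (x : H) :
    ContinuousOn (fun θ => T (θ * t) x) (Set.Icc 0 1) :=
  (hT.continuousOn x).comp (by fun_prop) fun _ hθ => mul_nonneg hθ.1 ht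

variable [CompleteSpace H]

theorem IsSemigroupOf.inner_phiOp_one {A : H →ₗ.[ℝ] H} {T : ℝ → H →L[ℝ] H}
    (hT : IsSemigroupOf A T) {t : ℝ} (ht : 0 ≤ t) (x y : H) :
    ⟪phiOp T 1 t x, y⟫ = ∫ θ in (0 : ℝ)..1, ⟪T (θ * t) x, y⟫ := by
  have hint := (hT.continuousOn_mul ht x).intervalIntegrable_of_Icc zero_le_one
    (μ := MeasureTheory.volume)
  rw [phiOp_one_eq, real_inner_comm]
  have := ((innerSL ℝ y).intervalIntegral_comp_comm hint).symm
  simpa [real_inner_comm] using this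

theorem IsSemigroupOf.exists_phiOp_one_eq {A : H →ₗ.[ℝ] H} {T : ℝ → H →L[ℝ] H}
    (hT : IsSemigroupOf A T) {t : ℝ} (ht : 0 ≤ t) :
    ∃ Φ : H →L[ℝ] H, ∀ x, Φ x = phiOp T 1 t x := by
  have hint := fun x => (hT.continuousOn_mul ht x).intervalIntegrable_of_Icc zero_le_one
    (μ := MeasureTheory.volume)
  obtain ⟨C, -, hC⟩ := hT.exists_norm_le t
  refine ⟨LinearMap.mkContinuousOfExistsBound
    { toFun := fun x => ∫ θ in (0 : ℝ)..1, T (θ * t) x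
      map_add' := fun x y => ?_
      map_smul' := fun r x => ?_ } ⟨C, fun x => ?_⟩, fun x => (phiOp_one_eq T t x).symm⟩
  · simp only [map_add]
    exact intervalIntegral.integral_add (hint x) (hint y)
  · simp only [map_smul, RingHom.id_apply]
    exact intervalIntegral.integral_smul _ _
  · refine (intervalIntegral.norm_integral_le_of_norm_le_const (C := C * ‖x‖)
      fun θ hθ => ?_).trans (by simp)
    rw [Set.uIoc_of_le zero_le_one] at hθ
    refine (T _).le_of_opNorm_le (hC _ ⟨mul_nonneg hθ.1.le ht, ?_⟩) x
    exact mul_le_of_le_one_left ht hθ.2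

/-- Weak convergence is enough later, and it reduces the operator integral to Riemann sums of a
scalar function. -/
theorem Symb.tendsto_inner_poly {A : H →ₗ.[ℝ] H} {T : ℝ → H →L[ℝ] H}
    (hT : IsSemigroupOf A T) {τ : ℝ} (hτ : 0 ≤ τ) (σ : Symb) (x y : H) :
    Tendsto (fun N : ℕ => ⟪Polynomial.aeval (T (τ / (9 * N)) : H →ₗ[ℝ] H) (σ.poly N) x, y⟫) atTop
      (𝓝 ⟪σ.op T τ x, y⟫) := by
  have hpow : ∀ N : ℕ, ∀ m : ℕ, ((T (τ / (9 * N)) : H →ₗ[ℝ] H) ^ m) x =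
      T (m * (τ / (9 * N))) x := fun N m => by
    rw [← hT.pow_eq (by positivity), ← ContinuousLinearMap.toLinearMap_pow]
    rfl
  cases σ with
  | exp m =>
    refine tendsto_const_nhds.congr' ?_
    filter_upwards [eventually_gt_atTop 0] with N hN
    have hN0 : (N : ℝ) ≠ 0 := by exact_mod_cast hN.ne'
    simp only [Symb.op, Symb.poly, map_pow, Polynomial.aeval_X, hpow]
    congr 3
    push_cast
    field_simp
  | avg m =>
    have ht : (0 : ℝ) ≤ m / 9 * τ := by positivity
    rw [Symb.op, hT.inner_phiOp_one ht]
    refine (tendsto_riemann_sum (f := fun θ => ⟪T (θ * (m / 9 * τ)) x, y⟫)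
      ((hT.continuousOn_mul ht x).inner continuousOn_const)).congr' ?_
    filter_upwards [eventually_gt_atTop 0] with N hN
    have hN0 : (N : ℝ) ≠ 0 := by exact_mod_cast hN.ne'
    simp only [Symb.poly, map_mul, map_sum, map_pow, Polynomial.aeval_X, Polynomial.aeval_C,
      Module.End.mul_apply, Module.algebraMap_end_apply, LinearMap.sum_apply, inner_smul_left,
      sum_inner, hpow, conj_trivial]
    rw [Finset.mul_sum]
    refine Finset.sum_congr rfl fun i _ => ?_
    congr 4
    push_cast
    field_simp

variable {S : GradientFlow H} {T : ℝ → H →L[ℝ] H}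

theorem Symb.exists_op_K_eq (hT : IsSemigroupOf S.opGL T) {τ : ℝ} (hτ : 0 ≤ τ) (σ : Symb) (w : H) :
    ∃ η, σ.op T τ (S.K w) = S.K η := by
  cases σ with
  | exp m => exact ⟨_, GradientFlow.semigroup_K_eq hT (by positivity) w⟩
  | avg m =>
    have ht : (0 : ℝ) ≤ m / 9 * τ := by positivity
    obtain ⟨Φ, hΦ⟩ := hT.exists_phiOp_one_eq ht
    refine ⟨ContinuousLinearMap.adjoint Φ w, ext_inner_right ℝ fun v => ?_⟩
    rw [S.inner_K_left, ContinuousLinearMap.adjoint_inner_left, hΦ, Symb.op,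
      hT.inner_phiOp_one ht, real_inner_comm, hT.inner_phiOp_one ht]
    refine intervalIntegral.integral_congr fun θ hθ => ?_
    rw [Set.uIcc_of_le zero_le_one] at hθ
    rw [GradientFlow.inner_semigroup_K hT (mul_nonneg hθ.1 ht), real_inner_comm]

end Operators

/-! ## The operator form of the energy inequality -/

/-- Linear combinations of symbols. -/
abbrev LinComb := List (ℝ × Symb)

namespace LinComb

/-- The value at a real number. -/
noncomputable def val (a : LinComb) (z : ℝ) : ℝ := (a.map fun p => p.1 * p.2.val z).sum

/-- The value at the operator `τ G L`, for `T t = e ^ (t G L)`. -/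
noncomputable def op {H : Type*} [NormedAddCommGroup H] [InnerProductSpace ℝ H]
    (T : ℝ → H →L[ℝ] H) (τ : ℝ) (a : LinComb) (x : H) : H :=
  (a.map fun p => p.1 • p.2.op T τ x).sum

/-- An approximation by a polynomial of `exp(z / (9 N))`. -/
noncomputable def poly (N : ℕ) (a : LinComb) : Polynomial ℝ :=
  (a.map fun p => Polynomial.C p.1 * p.2.poly N).sum

/-- The sum of the absolute values of the coefficients. -/
noncomputable def size (a : LinComb) : ℝ := (a.map fun p => |p.1|).sum

theorem size_nonneg (a : LinComb) : 0 ≤ a.size :=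
  List.sum_nonneg fun x hx => by
    obtain ⟨p, -, rfl⟩ := List.mem_map.1 hx
    exact abs_nonneg _

theorem abs_val_le (a : LinComb) {z : ℝ} (hz : z < 0) : |a.val z| ≤ a.size := by
  induction a with
  | nil => simp [val, size]
  | cons p a ih =>
    simp only [val, size, List.map_cons, List.sum_cons] at ih ⊢
    refine (abs_add_le _ _).trans (add_le_add ?_ ih)
    rw [abs_mul]
    exact mul_le_of_le_one_right (abs_nonneg _) (p.2.abs_val_le hz)

theorem abs_eval_poly_sub_le (a : LinComb) {z : ℝ} (hz : z < 0) {N : ℕ} (hN : 0 < N) :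
    |(a.poly N).eval (Real.exp (z / (9 * N))) - a.val z| ≤ a.size * (N : ℝ)⁻¹ := by
  induction a with
  | nil => simp [val, size, poly]
  | cons p a ih =>
    simp only [val, size, poly, List.map_cons, List.sum_cons, Polynomial.eval_add,
      Polynomial.eval_mul, Polynomial.eval_C] at ih ⊢
    rw [add_sub_add_comm, add_mul, ← mul_sub]
    refine (abs_add_le _ _).trans (add_le_add ?_ ih)
    rw [abs_mul]
    exact mul_le_mul_of_nonneg_left (p.2.abs_eval_poly_sub_le hz hN) (abs_nonneg _)

variable {H : Type*} [NormedAddCommGroup H] [InnerProductSpace ℝ H] [CompleteSpace H]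

theorem tendsto_inner_poly {A : H →ₗ.[ℝ] H} {T : ℝ → H →L[ℝ] H}
    (hT : IsSemigroupOf A T) {τ : ℝ} (hτ : 0 ≤ τ) (a : LinComb) (x y : H) :
    Tendsto (fun N : ℕ => ⟪Polynomial.aeval (T (τ / (9 * N)) : H →ₗ[ℝ] H) (a.poly N) x, y⟫) atTop
      (𝓝 ⟪a.op T τ x, y⟫) := by
  induction a with
  | nil => simp [poly, op]
  | cons p a ih =>
    simp only [poly, op, List.map_cons, List.sum_cons, map_add, map_mul, Polynomial.aeval_C,
      LinearMap.add_apply, Module.End.mul_apply, Module.algebraMap_end_apply, inner_add_left,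
      inner_smul_left, conj_trivial] at ih ⊢
    exact ((p.2.tendsto_inner_poly hT hτ x y).const_mul _).add ih

theorem exists_op_K_eq {S : GradientFlow H} {T : ℝ → H →L[ℝ] H} (hT : IsSemigroupOf S.opGL T)
    {τ : ℝ} (hτ : 0 ≤ τ) (a : LinComb) (w : H) : ∃ η, a.op T τ (S.K w) = S.K η := by
  induction a with
  | nil => exact ⟨0, by simp [op]⟩
  | cons p a ih =>
    obtain ⟨η, hη⟩ := ih
    obtain ⟨ζ, hζ⟩ := p.2.exists_op_K_eq hT hτ w
    refine ⟨p.1 • ζ + η, ?_⟩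
    simp only [op, List.map_cons, List.sum_cons] at hη ⊢
    rw [hη, hζ, map_add, map_smul]

end LinComb

/-- The form is quadratic in the matrix; `η ≤ C` makes the second-order error linear in `η`. The
constant is not sharp. -/
theorem energyForm_le_of_abs_sub_le {X Y : Matrix (Fin 3) (Fin 3) ℝ} {C η : ℝ} (hη : η ≤ C)
    (hX : ∀ k j, |X k j| ≤ C) (hY : ∀ k j, |Y k j - X k j| ≤ η) (c : Fin 3 → ℝ) :
    energyForm Y c ≤ energyForm X c + (9 / 2 * C + 15) * η * ∑ j, c j ^ 2 := by
  have hη0 : 0 ≤ η := (abs_nonneg _).trans (hY 0 0)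
  set s := |c 0| + |c 1| + |c 2| with hs
  have hs0 : 0 ≤ s := by positivity
  have hsq : s ^ 2 ≤ 3 * ∑ j, c j ^ 2 := by
    rw [Fin.sum_univ_three, ← sq_abs (c 0), ← sq_abs (c 1), ← sq_abs (c 2), hs]
    nlinarith [sq_nonneg (|c 0| - |c 1|), sq_nonneg (|c 0| - |c 2|), sq_nonneg (|c 1| - |c 2|)]
  have hmul : ∀ (Z : Matrix (Fin 3) (Fin 3) ℝ) (B : ℝ), (∀ k j, |Z k j| ≤ B) → ∀ k,
      |(Z *ᵥ c) k| ≤ B * s := by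
    intro Z B hZ k
    simp only [Matrix.mulVec, dotProduct, Fin.sum_univ_three]
    refine (abs_add_three _ _ _).trans ?_
    simp only [abs_mul]
    have := mul_le_mul_of_nonneg_right (hZ k 0) (abs_nonneg (c 0))
    have := mul_le_mul_of_nonneg_right (hZ k 1) (abs_nonneg (c 1))
    have := mul_le_mul_of_nonneg_right (hZ k 2) (abs_nonneg (c 2))
    rw [hs]
    linarith
  obtain ⟨δ, hδ⟩ : ∃ δ : Fin 3 → ℝ, δ = (Y - X) *ᵥ c := ⟨_, rfl⟩
  have hYc : Y *ᵥ c = X *ᵥ c + δ := by rw [hδ, Matrix.sub_mulVec]; abel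
  have hδk : ∀ k, |δ k| ≤ η * s := by rw [hδ]; exact hmul _ _ hY
  have hXk := hmul X C hX 2
  have hprod : ∀ j k, |c j * δ k| ≤ |c j| * (η * s) := fun j k => by
    rw [abs_mul]; exact mul_le_mul_of_nonneg_left (hδk k) (abs_nonneg _)
  have h1 : (X *ᵥ c) 2 * δ 2 ≤ C * s * (η * s) := by
    refine (le_abs_self _).trans ?_
    rw [abs_mul]
    exact mul_le_mul hXk (hδk 2) (abs_nonneg _) (by nlinarith)
  have h2 : δ 2 ^ 2 ≤ C * s * (η * s) := by
    rw [← sq_abs, sq]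
    have : |δ 2| ≤ C * s := (hδk 2).trans (mul_le_mul_of_nonneg_right hη hs0)
    exact mul_le_mul this (hδk 2) (abs_nonneg _) (by nlinarith)
  have h3 := (abs_le.1 (hprod 0 0)).2
  have h4 := (abs_le.1 (hprod 1 1)).2
  have h5 := (abs_le.1 (hprod 1 0)).1
  have h6 := (abs_le.1 (hprod 2 2)).2
  have h7 := (abs_le.1 (hprod 2 1)).1
  have h8 : |c 0| * (η * s) + 2 * (|c 1| * (η * s)) + 2 * (|c 2| * (η * s)) ≤ 2 * (η * s ^ 2) := by
    have h0 : 0 ≤ |c 0| * (η * s) := by positivity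
    have : η * s ^ 2 = (|c 0| + |c 1| + |c 2|) * (η * s) := by rw [← hs]; ring
    rw [this]
    linarith
  have h9 : (3 / 2 * C + 2) * η * s ^ 2 ≤ (3 / 2 * C + 2) * η * (3 * ∑ j, c j ^ 2) :=
    mul_le_mul_of_nonneg_left hsq (mul_nonneg (by linarith) hη0)
  have h10 : 0 ≤ η * ∑ j, c j ^ 2 := mul_nonneg hη0 (Finset.sum_nonneg fun j _ => sq_nonneg _)
  simp only [energyForm, hYc, Pi.add_apply]
  linarith

section Operators

variable {H : Type*} [NormedAddCommGroup H] [InnerProductSpace ℝ H] [CompleteSpace H]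
  {S : GradientFlow H} {T : ℝ → H →L[ℝ] H}

theorem K_aeval_adjoint (hT : IsSemigroupOf S.opGL T) {t : ℝ} (ht : 0 ≤ t) (p : Polynomial ℝ)
    (w : H) : S.K (Polynomial.aeval (ContinuousLinearMap.adjoint (T t) : H →ₗ[ℝ] H) p w) =
      Polynomial.aeval (T t : H →ₗ[ℝ] H) p (S.K w) := by
  induction p using Polynomial.induction_on' with
  | add p p' hp hp' => simp only [map_add, LinearMap.add_apply, hp, hp']
  | monomial m a =>
    have : ∀ m : ℕ, S.K (((ContinuousLinearMap.adjoint (T t) : H →ₗ[ℝ] H) ^ m) w) =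
        ((T t : H →ₗ[ℝ] H) ^ m) (S.K w) := by
      intro m
      induction m with
      | zero => simp
      | succ m ih =>
        rw [pow_succ', pow_succ', Module.End.mul_apply, Module.End.mul_apply, ← ih]
        exact (GradientFlow.semigroup_K_eq hT ht _).symm
    simp only [Polynomial.aeval_monomial, Module.End.mul_apply, Module.algebraMap_end_apply,
      map_smul, this]

/-- If the symbol of the energy form is negative semidefinite on the negative half-line, then so is
the energy form of the operator. -/
theorem energyForm_op_nonpos (hT : IsSemigroupOf S.opGL T) {τ : ℝ} (hτ : 0 ≤ τ)
    (α : Fin 3 → Fin 3 → LinComb)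
    (hα : ∀ z < 0, ∀ c, energyForm (Matrix.of fun k j => (α k j).val z) c ≤ 0)
    (q x : Fin 3 → H) (hx : ∀ k, x k = ∑ j, (α k j).op T τ (S.K (q j))) :
    ∃ η, x 2 = S.K η ∧
      1 / 2 * ⟪S.K η, η⟫ + (⟪q 0, x 0⟫ + ⟪q 1, x 1 - x 0⟫ + ⟪q 2, x 2 - x 1⟫) ≤ 0 := by
  obtain ⟨η, hη⟩ : ∃ η, x 2 = S.K η := by
    choose η hη using fun j => (α 2 j).exists_op_K_eq hT hτ (q j)
    exact ⟨∑ j, η j, by rw [hx, map_sum]; exact Finset.sum_congr rfl fun j _ => hη j⟩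
  refine ⟨η, hη, ?_⟩
  let C : ℝ := ∑ k, ∑ j, (α k j).size
  have hC : ∀ k j, (α k j).size ≤ C := fun k j =>
    (Finset.single_le_sum (f := fun j => (α k j).size) (fun _ _ => LinComb.size_nonneg _)
      (Finset.mem_univ j)).trans
    (Finset.single_le_sum (f := fun k => ∑ j, (α k j).size)
      (fun _ _ => Finset.sum_nonneg fun _ _ => LinComb.size_nonneg _) (Finset.mem_univ k))
  have hC0 : 0 ≤ C := (LinComb.size_nonneg _).trans (hC 0 0)
  let X : ℕ → Matrix (Fin 3) (Fin 3) (Polynomial ℝ) := fun N => Matrix.of fun k j => (α k j).poly N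
  let ε : ℕ → ℝ := fun N => (9 / 2 * C + 15) * (C * (N : ℝ)⁻¹)
  have hform : ∀ N : ℕ, 0 < N → ∀ μ ∈ Set.Icc (0 : ℝ) 1, ∀ c : Fin 3 → ℝ,
      energyForm ((X N).map (Polynomial.eval μ)) c ≤ ε N * ∑ j, c j ^ 2 := by
    intro N hN μ hμ c
    have hN0 : (0 : ℝ) < N := by exact_mod_cast hN
    have hclosed : IsClosed {μ : ℝ | energyForm ((X N).map (Polynomial.eval μ)) c ≤
        ε N * ∑ j, c j ^ 2} := by
      refine isClosed_le ?_ continuous_const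
      simp only [energyForm, Matrix.mulVec, dotProduct, Matrix.map_apply]
      fun_prop
    rw [← closure_Ioo (zero_ne_one' ℝ)] at hμ
    -- Only `0 < μ < 1` has the form `exp(z / (9 N))` with `z < 0`; the endpoints follow by
    -- continuity.
    refine hclosed.closure_subset_iff.2 (fun μ hμ => ?_) hμ
    obtain ⟨z, hz, rfl⟩ : ∃ z < 0, μ = Real.exp (z / (9 * N)) := by
      refine ⟨9 * N * Real.log μ, mul_neg_of_pos_of_neg (by positivity)
        (Real.log_neg hμ.1 hμ.2), ?_⟩
      rw [mul_div_cancel_left₀ _ (by positivity), Real.exp_log hμ.1]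
    have h := energyForm_le_of_abs_sub_le (X := Matrix.of fun k j => (α k j).val z)
      (Y := (X N).map (Polynomial.eval (Real.exp (z / (9 * N))))) (C := C) (η := C * (N : ℝ)⁻¹)
      (mul_le_of_le_one_right hC0 (inv_le_one_of_one_le₀ (by exact_mod_cast hN)))
      (fun k j => ((α k j).abs_val_le hz).trans (hC k j))
      (fun k j => ((α k j).abs_eval_poly_sub_le hz hN).trans
        (mul_le_mul_of_nonneg_right (hC k j) (by positivity))) c
    have h' := hα z hz c
    change energyForm _ c ≤ ε N * ∑ j, c j ^ 2
    exact h.trans (by simp only [ε]; linarith)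
  let xN : ℕ → Fin 3 → H := fun N k =>
    ∑ j, Polynomial.aeval (T (τ / (9 * N)) : H →ₗ[ℝ] H) (X N k j) (S.K (q j))
  have hxN : ∀ k y, Tendsto (fun N => ⟪xN N k, y⟫) atTop (𝓝 ⟪x k, y⟫) := by
    intro k y
    simp only [xN, hx, sum_inner]
    exact tendsto_finsetSum _ fun j _ => (α k j).tendsto_inner_poly hT hτ _ _
  -- The quadratic term is replaced by its tangent at `η`, so the left side is affine in `xN N` and
  -- passes to the weak limit.
  have hle : ∀ N : ℕ, 0 < N → ⟪xN N 2, η⟫ - 1 / 2 * ⟪S.K η, η⟫ +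
      (⟪xN N 0, q 0⟫ + (⟪xN N 1, q 1⟫ - ⟪xN N 0, q 1⟫) + (⟪xN N 2, q 2⟫ - ⟪xN N 1, q 2⟫)) ≤
        ε N * ∑ j, ⟪S.K (q j), q j⟫ := by
    intro N hN
    have ht : 0 ≤ τ / (9 * N) := by positivity
    let B : H →ₗ[ℝ] H := (ContinuousLinearMap.adjoint (T (τ / (9 * N))) : H →ₗ[ℝ] H)
    let ξ : Fin 3 → H := fun k => ∑ j, Polynomial.aeval B (X N k j) (q j)
    have hKB : ∀ w, S.K (B w) = T (τ / (9 * N)) (S.K w) := fun w =>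
      (GradientFlow.semigroup_K_eq hT ht w).symm
    have hKξ : ∀ k, S.K (ξ k) = xN N k := fun k => by
      simp only [ξ, xN, map_sum]
      exact Finset.sum_congr rfl fun j _ => K_aeval_adjoint hT ht _ _
    have key : 1 / 2 * ⟪S.K (ξ 2), ξ 2⟫ + (⟪S.K (q 0), ξ 0⟫ + ⟪S.K (q 1), ξ 1 - ξ 0⟫ +
        ⟪S.K (q 2), ξ 2 - ξ 1⟫) ≤ ε N * ∑ j, ⟪S.K (q j), q j⟫ :=
      energyForm_aeval_le_of_core S.innerCore (B := B)
        (fun w w' => by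
          change ⟪S.K (B w), w'⟫ = ⟪S.K w, B w'⟫
          rw [hKB, S.inner_K_left, hKB, GradientFlow.inner_semigroup_K hT ht])
        (fun w => by
          change 0 ≤ ⟪S.K (B w), w⟫
          rw [hKB]; exact GradientFlow.inner_semigroup_K_self_nonneg hT ht w)
        (fun w => by
          change ⟪S.K (B w), w⟫ ≤ ⟪S.K w, w⟫
          rw [hKB]; exact GradientFlow.inner_semigroup_K_self_le hT ht w)
        (X N) (hform N hN) q ξ fun k => rfl
    -- This is the tangent inequality `⟪K ξ, η⟫ - ½⟪K η, η⟫ ≤ ½⟪K ξ, ξ⟫`.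
    have hsq := S.inner_K_self_nonneg (ξ 2 - η)
    have hcross : ⟪S.K η, ξ 2⟫ = ⟪S.K (ξ 2), η⟫ := by rw [S.inner_K_left, real_inner_comm]
    have hqξ : ∀ j k, ⟪S.K (q j), ξ k⟫ = ⟪xN N k, q j⟫ := fun j k => by
      rw [S.inner_K_left, hKξ, real_inner_comm]
    rw [map_sub, inner_sub_left, inner_sub_right, inner_sub_right, hcross, hKξ] at hsq
    rw [inner_sub_right, inner_sub_right, hqξ, hqξ, hqξ, hqξ, hqξ, hKξ] at key
    linarith
  have hlim : Tendsto (fun N => ⟪xN N 2, η⟫ - 1 / 2 * ⟪S.K η, η⟫ +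
      (⟪xN N 0, q 0⟫ + (⟪xN N 1, q 1⟫ - ⟪xN N 0, q 1⟫) + (⟪xN N 2, q 2⟫ - ⟪xN N 1, q 2⟫))) atTop
      (𝓝 (⟪x 2, η⟫ - 1 / 2 * ⟪S.K η, η⟫ +
        (⟪x 0, q 0⟫ + (⟪x 1, q 1⟫ - ⟪x 0, q 1⟫) + (⟪x 2, q 2⟫ - ⟪x 1, q 2⟫)))) :=
    ((hxN _ _).sub_const _).add (((hxN _ _).add ((hxN _ _).sub (hxN _ _))).add
      ((hxN _ _).sub (hxN _ _)))
  have hε : Tendsto (fun N => ε N * ∑ j, ⟪S.K (q j), q j⟫) atTop (𝓝 0) := by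
    have h := (((tendsto_inv_atTop_nhds_zero_nat (𝕜 := ℝ)).const_mul C).const_mul
      (9 / 2 * C + 15)).mul_const (∑ j, ⟪S.K (q j), q j⟫)
    simpa [ε] using h
  have hfin := le_of_tendsto_of_tendsto hlim hε (by
    filter_upwards [eventually_gt_atTop 0] with N hN using hle N hN)
  rw [hη] at hfin ⊢
  rw [inner_sub_right, inner_sub_right, real_inner_comm (x 0) (q 0), real_inner_comm (x 1) (q 1),
    real_inner_comm (x 0) (q 1), real_inner_comm (S.K η) (q 2), real_inner_comm (x 1) (q 2)]
  linarith

end Operators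

/-! ## Energy decrease -/

theorem Tableau.dotProduct_Delta'_mulVec {s : ℕ} (tab : Tableau s) (z : ℝ) (v : Fin s → ℝ) :
    v ⬝ᵥ (tab.Delta' z *ᵥ v) =
      z * (((tab.P z)ᵀ *ᵥ v) ⬝ᵥ (matE s *ᵥ ((tab.P z)ᵀ *ᵥ v))) +
        2 * (v ⬝ᵥ (matEL s *ᵥ ((tab.P z)ᵀ *ᵥ v))) := by
  have h : v ⬝ᵥ ((tab.P z * (matEL s)ᵀ) *ᵥ v) = v ⬝ᵥ ((matEL s * (tab.P z)ᵀ) *ᵥ v) := by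
    rw [Matrix.dotProduct_mulVec, ← Matrix.mulVec_transpose, Matrix.transpose_mul,
      Matrix.transpose_transpose, dotProduct_comm]
  have h' : v ⬝ᵥ ((tab.P z * matE s * (tab.P z)ᵀ) *ᵥ v) =
      ((tab.P z)ᵀ *ᵥ v) ⬝ᵥ (matE s *ᵥ ((tab.P z)ᵀ *ᵥ v)) := by
    rw [Matrix.mul_assoc, ← Matrix.mulVec_mulVec, Matrix.dotProduct_mulVec,
      ← Matrix.mulVec_transpose, Matrix.mulVec_mulVec]
  rw [Tableau.Delta', Matrix.add_mulVec, Matrix.add_mulVec, Matrix.smul_mulVec, dotProduct_add,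
    dotProduct_add, dotProduct_smul, h, h', ← Matrix.mulVec_mulVec, smul_eq_mul]
  ring

/-- With `w = P c`, choose `v` so that `Pᵀ v` lists the increments of `w`. Then `E_L` sums them back
to `w`, `E` produces `w₃²`, and `v ⬝ w` equals the increments paired with `c`, so the form is `z/2`
times `v ⬝ Δ' v`. -/
theorem Tableau.energyForm_nonpos {tab : Tableau 3} {z : ℝ} (hz : z < 0)
    (h : (tab.Delta' z).PosDef) (c : Fin 3 → ℝ) : energyForm (z • tab.P z) c ≤ 0 := by
  -- Every term of `v ⬝ Δ' v` contains `Pᵀ v`, so definiteness of `Δ'` forces `P` to be invertible.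
  have hinj : Function.Injective (tab.P z)ᵀ.mulVec := by
    intro v v' hv
    by_contra hne
    have hpos := h.dotProduct_mulVec_pos (sub_ne_zero.2 hne)
    have h0 : (tab.P z)ᵀ *ᵥ (v - v') = 0 := by
      rw [Matrix.mulVec_sub]; exact sub_eq_zero.2 hv
    rw [star_trivial, tab.dotProduct_Delta'_mulVec, h0] at hpos
    simp at hpos
  let w := tab.P z *ᵥ c
  obtain ⟨v, hv⟩ := (Matrix.mulVec_surjective_iff_isUnit.2
    (Matrix.mulVec_injective_iff_isUnit.1 hinj)) ![w 0, w 1 - w 0, w 2 - w 1]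
  have hnonneg : 0 ≤ v ⬝ᵥ (tab.Delta' z *ᵥ v) := by
    simpa using h.posSemidef.dotProduct_mulVec_nonneg v
  have hEL : matEL 3 *ᵥ ![w 0, w 1 - w 0, w 2 - w 1] = w := by
    ext i
    fin_cases i <;> simp [Matrix.mulVec, dotProduct, Fin.sum_univ_three, matEL]
  have hE : ![w 0, w 1 - w 0, w 2 - w 1] ⬝ᵥ (matE 3 *ᵥ ![w 0, w 1 - w 0, w 2 - w 1]) =
      w 2 ^ 2 := by
    simp only [Matrix.mulVec, dotProduct, Fin.sum_univ_three, matE, Matrix.of_apply]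
    simp
    ring
  have hvw : v ⬝ᵥ w = ![w 0, w 1 - w 0, w 2 - w 1] ⬝ᵥ c := by
    rw [Matrix.dotProduct_mulVec, ← Matrix.mulVec_transpose, hv]
  rw [tab.dotProduct_Delta'_mulVec, hv, hEL, hE, hvw] at hnonneg
  have e : energyForm (z • tab.P z) c =
      z / 2 * (z * w 2 ^ 2 + 2 * (![w 0, w 1 - w 0, w 2 - w 1] ⬝ᵥ c)) := by
    simp only [energyForm, Matrix.smul_mulVec, Pi.smul_apply, smul_eq_mul, dotProduct,
      Fin.sum_univ_three]
    simp [w]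
    ring
  rw [e]
  exact mul_nonpos_of_nonpos_of_nonneg (by linarith) hnonneg

namespace GradientFlow

variable {H : Type*} [NormedAddCommGroup H] [InnerProductSpace ℝ H] [CompleteSpace H]
  (S : GradientFlow H)

/-- The descent lemma for a functional with Lipschitz continuous gradient. -/
theorem F_add_le (v d : H) : S.F (v + d) ≤ S.F v + ⟪S.f v, d⟫ + S.β / 2 * ‖d‖ ^ 2 := by
  have hd : ∀ s : ℝ, HasDerivAt (fun s : ℝ => S.F (v + s • d)) ⟪S.f (v + s • d), d⟫ s := by
    intro s
    have h1 : HasDerivAt (fun s : ℝ => v + s • d) d s := by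
      simpa using ((hasDerivAt_id s).smul_const d).const_add v
    have h2 := (S.f_gradient (v + s • d)).hasFDerivAt.comp_hasDerivAt s h1
    exact h2.congr_deriv (by simp)
  have hB : ∀ s : ℝ, HasDerivAt (fun s : ℝ => S.F v + s * ⟪S.f v, d⟫ + S.β / 2 * ‖d‖ ^ 2 * s ^ 2)
      (⟪S.f v, d⟫ + S.β * ‖d‖ ^ 2 * s) s := by
    intro s
    have h := (((hasDerivAt_id s).mul_const ⟪S.f v, d⟫).const_add (S.F v)).add
      ((hasDerivAt_pow 2 s).const_mul (S.β / 2 * ‖d‖ ^ 2))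
    exact h.congr_deriv (by simp; ring)
  have key := image_le_of_deriv_right_le_deriv_boundary (a := 0) (b := 1)
    (fun s _ => (hd s).continuousAt.continuousWithinAt) (fun s _ => (hd s).hasDerivWithinAt)
    (by simp) (fun s _ => (hB s).continuousAt.continuousWithinAt)
    (fun s _ => (hB s).hasDerivWithinAt) (fun s hs => by
      have h1 : ⟪S.f (v + s • d) - S.f v, d⟫ ≤ S.β * ‖s • d‖ * ‖d‖ := by
        refine (real_inner_le_norm _ _).trans (mul_le_mul_of_nonneg_right ?_ (norm_nonneg _))
        simpa using S.f_lipschitz (v + s • d) v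
      rw [inner_sub_left, norm_smul, Real.norm_eq_abs, abs_of_nonneg hs.1] at h1
      linarith) (Set.right_mem_Icc.2 (zero_le_one' ℝ))
  simpa using key

/-- This is concavity of `F - β/2 ‖·‖²`, whose gradient is `-g`. -/
theorem F_sub_le {v w d : H} (hw : w = v + d) :
    S.F w - S.β / 2 * ‖w‖ ^ 2 ≤ S.F v - S.β / 2 * ‖v‖ ^ 2 - ⟪S.g v, d⟫ := by
  have h := S.F_add_le v d
  rw [hw, norm_add_sq_real, g, inner_sub_left, inner_smul_left, conj_trivial]
  linarith

theorem energy_eq (u : S.calL.domain) :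
    S.energy u = 1 / 2 * ⟪S.L u, (u : H)⟫ + (S.F u - S.β / 2 * ‖(u : H)‖ ^ 2) := by
  have h : S.L u = S.β • (u : H) + S.calL u := rfl
  rw [energy, h, inner_add_left, inner_smul_left, real_inner_self_eq_norm_sq, conj_trivial]
  ring

/-- The energy decreases along stages whose increments have a nonpositive energy form. -/
theorem energy_le_of_stages (u : S.calL.domain) {v : Fin 3 → H} {u' : H} (x : Fin 3 → H)
    (h0 : v 0 = u) (h1 : v 1 = u + x 0) (h2 : v 2 = u + x 1) (h3 : u' = u + x 2) {η : H}
    (hη : x 2 = S.K η)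
    (hneg : 1 / 2 * ⟪S.K η, η⟫ + (⟪S.L u - S.g (v 0), x 0⟫ + ⟪S.L u - S.g (v 1), x 1 - x 0⟫ +
      ⟪S.L u - S.g (v 2), x 2 - x 1⟫) ≤ 0) :
    ∃ hu' : u' ∈ S.calL.domain, S.energy ⟨u', hu'⟩ ≤ S.energy u := by
  have huK : (u : H) = S.K (S.L u) := (S.K_L u).symm
  have hu'K : u' = S.K (S.L u + η) := by rw [h3, hη, map_add, ← huK]
  have hu' : u' ∈ S.calL.domain := hu'K ▸ S.K_mem _
  refine ⟨hu', ?_⟩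
  have hLu' : S.L ⟨u', hu'⟩ = S.L u + η := by
    rw [← S.L_K (S.L u + η)]
    congr 1
    exact Subtype.ext hu'K
  -- One concavity inequality per increment, each based at the stage where `g` is evaluated; their
  -- sum telescopes.
  have f1 := S.F_sub_le (h1.trans (by rw [h0]) : v 1 = v 0 + x 0)
  have f2 := S.F_sub_le (h2.trans (by rw [h1]; abel) : v 2 = v 1 + (x 1 - x 0))
  have f3 := S.F_sub_le (h3.trans (by rw [h2]; abel) : u' = v 2 + (x 2 - x 1))
  have hcross : ⟪η, (u : H)⟫ = ⟪S.L u, S.K η⟫ := by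
    rw [← S.inner_K_left, ← huK, real_inner_comm]
  have hL : ⟪S.L ⟨u', hu'⟩, u'⟫ = ⟪S.L u, (u : H)⟫ + 2 * ⟪S.L u, x 2⟫ + ⟪S.K η, η⟫ := by
    rw [hLu', h3, hη, inner_add_left, inner_add_right, inner_add_right, hcross,
      real_inner_comm (S.K η) η]
    ring
  rw [energy_eq, energy_eq]
  change 1 / 2 * ⟪S.L ⟨u', hu'⟩, u'⟫ + (S.F u' - S.β / 2 * ‖u'‖ ^ 2) ≤ _
  rw [hL]
  rw [h0] at f1 hneg
  simp only [inner_sub_left, inner_sub_right] at hneg f1 f2 f3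
  linarith

end GradientFlow

/-- A criterion of energy decrease: `α` is the matrix `z P(z)` written in symbols, and the increments
of the stages are given by the corresponding operators. -/
theorem Tableau.unconditionallyDecreasesEnergy_of_linComb {tab : Tableau 3}
    (hpos : ∀ z < 0, (tab.Delta' z).PosDef) (α : Fin 3 → Fin 3 → LinComb)
    (hα : ∀ z < 0, Matrix.of (fun k j => (α k j).val z) = z • tab.P z)
    (hstep : ∀ (H : Type w) [NormedAddCommGroup H] [InnerProductSpace ℝ H] [CompleteSpace H]
      (S : GradientFlow H) (T : ℝ → H →L[ℝ] H), IsSemigroupOf S.opGL T →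
      ∀ τ : ℝ, 0 < τ → ∀ (w : H) (v q : Fin 3 → H) (u' : H),
        IsStep tab S.L T S.g τ (S.K w) v u' → (∀ j, q j = w - S.g (v j)) →
        v 0 = S.K w ∧ v 1 = S.K w + ∑ j, (α 0 j).op T τ (S.K (q j)) ∧
          v 2 = S.K w + ∑ j, (α 1 j).op T τ (S.K (q j)) ∧
          u' = S.K w + ∑ j, (α 2 j).op T τ (S.K (q j))) :
    Tableau.UnconditionallyDecreasesEnergy.{w} tab := by
  intro H _ _ _ S T hT τ hτ u v u' h
  have huK : S.K (S.L u) = (u : H) := S.K_L u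
  obtain ⟨h0, h1, h2, h3⟩ := hstep H S T hT τ hτ (S.L u) v (fun j => S.L u - S.g (v j)) u'
    (by rw [huK]; exact h) fun j => rfl
  rw [huK] at h0 h1 h2 h3
  obtain ⟨η, hη, hneg⟩ := energyForm_op_nonpos hT hτ.le α
    (fun z hz c => by rw [hα z hz]; exact Tableau.energyForm_nonpos hz (hpos z hz) c)
    (fun j => S.L u - S.g (v j)) (fun k => ∑ j, (α k j).op T τ (S.K (S.L u - S.g (v j))))
    fun k => rfl
  exact S.energy_le_of_stages u (fun k => ∑ j, (α k j).op T τ (S.K (S.L u - S.g (v j))))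
    h0 h1 h2 h3 hη hneg

/-! ## The two schemes: energy decrease -/

section Terms

variable {H : Type*} [NormedAddCommGroup H] [InnerProductSpace ℝ H] [CompleteSpace H]
  (S : GradientFlow H) (T : ℝ → H →L[ℝ] H)

theorem smul_opG_term_one {τ : ℝ} (hτ : τ ≠ 0) (q : ℝ) {c : ℝ} (hc : c ≠ 0) (w : H) :
    τ • (term q 1 c).opG S.L T τ w = (q / c) • (T (c * τ) (S.K w) - S.K w) := by
  simp only [PhiTerm.opG, term, phiOpG, phiOp, S.opInv_L, smul_smul, Nat.sub_self,
    Nat.factorial_zero, Nat.cast_one, div_one, one_smul]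
  congr 1
  field_simp

theorem smul_opG_term_two {τ : ℝ} (hτ : τ ≠ 0) (q : ℝ) {c : ℝ} (hc : c ≠ 0) (w : H) :
    τ • (term q 2 c).opG S.L T τ w = (q / c) • (phiOp T 1 (c * τ) (S.K w) - S.K w) := by
  simp only [PhiTerm.opG, term, phiOpG, S.opInv_L, smul_smul, Nat.add_one_sub_one,
    Nat.factorial_one, Nat.cast_one, div_one, one_smul]
  congr 1
  field_simp

end Terms

open Symb in
/-- The matrix `z P(z)` of the scheme `EDETDRK3`. -/
noncomputable def linCombEDETDRK3 : Fin 3 → Fin 3 → LinComb :=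
  ![![[(1, exp 9), (-1, exp 0)], [], []],
    ![[(1, exp 6), (-1 / 3, exp 0), (-2 / 3, avg 6)], [(2 / 3, avg 6), (-2 / 3, exp 0)], []],
    ![[(3 / 4, exp 9), (1 / 4, exp 0), (-1, avg 9)],
      [(1, avg 9), (-1 / 2, exp 0), (-1 / 2, exp 9)], [(3 / 4, exp 9), (-3 / 4, exp 0)]]]

open Symb in
/-- The matrix `z P(z)` of the scheme `EDETDRK3b`. -/
noncomputable def linCombEDETDRK3b : Fin 3 → Fin 3 → LinComb :=
  ![![[(1, exp 4), (-1, exp 0)], [], []],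
    ![[(1, exp 6), (1 / 2, exp 0), (-3 / 2, avg 6)], [(3 / 2, avg 6), (-3 / 2, exp 0)], []],
    ![[(1, exp 9), (1 / 2, exp 0), (-3 / 2, avg 9)], [], [(3 / 2, avg 9), (-3 / 2, exp 0)]]]

theorem linCombEDETDRK3_val {z : ℝ} (hz : z < 0) :
    Matrix.of (fun k j => (linCombEDETDRK3 k j).val z) = z • EDETDRK3.P z := by
  have h1 : z ≠ 0 := hz.ne
  have h2 : 2 / 3 * z ≠ 0 := mul_ne_zero (by norm_num) h1
  have e9 : (9 / 9 * z : ℝ) = z := by ring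
  have e6 : (6 / 9 * z : ℝ) = 2 / 3 * z := by ring
  rw [EDETDRK3_P, phi_two_of_ne h1, phi_two_of_ne h2]
  ext i j
  fin_cases i <;> fin_cases j <;>
    simp [linCombEDETDRK3, LinComb.val, Symb.val, e6, phi_one_of_ne h1, phi_one_of_ne h2] <;>
    field_simp <;> ring

theorem linCombEDETDRK3b_val {z : ℝ} (hz : z < 0) :
    Matrix.of (fun k j => (linCombEDETDRK3b k j).val z) = z • EDETDRK3b.P z := by
  have h1 : z ≠ 0 := hz.ne
  have h2 : 2 / 3 * z ≠ 0 := mul_ne_zero (by norm_num) h1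
  have h3 : 4 / 9 * z ≠ 0 := mul_ne_zero (by norm_num) h1
  have e6 : (6 / 9 * z : ℝ) = 2 / 3 * z := by ring
  rw [EDETDRK3b_P, phi_two_of_ne h1, phi_two_of_ne h2]
  ext i j
  fin_cases i <;> fin_cases j <;>
    simp [linCombEDETDRK3b, LinComb.val, Symb.val, e6, phi_one_of_ne h1, phi_one_of_ne h2,
      phi_one_of_ne h3] <;>
    field_simp <;> ring

theorem EDETDRK3_unconditionallyDecreasesEnergy
    (hpos : ∀ z < 0, (EDETDRK3.Delta' z).PosDef) :
    Tableau.UnconditionallyDecreasesEnergy.{w} EDETDRK3 := by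
  refine Tableau.unconditionallyDecreasesEnergy_of_linComb hpos linCombEDETDRK3
    (fun z hz => linCombEDETDRK3_val hz) ?_
  intro H _ _ _ S T hT τ hτ w v q u' h hq
  have hτ0 : τ ≠ 0 := hτ.ne'
  have hg : ∀ j, S.K (S.g (v j)) = S.K w - S.K (q j) := fun j => by
    rw [hq, map_sub, sub_sub_cancel]
  obtain ⟨Φ₆, hΦ₆⟩ := hT.exists_phiOp_one_eq (t := 2 / 3 * τ) (by positivity)
  obtain ⟨Φ₉, hΦ₉⟩ := hT.exists_phiOp_one_eq (t := τ) hτ.le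
  have e6 : (6 / 9 * τ : ℝ) = 2 / 3 * τ := by ring
  have h0 := h.stage 0
  have h1 := h.stage 1
  have h2 := h.stage 2
  have h3 := h.next
  have f1 : (Finset.univ.filter fun j : Fin 3 => j < 1) = {0} := by decide
  have f2 : (Finset.univ.filter fun j : Fin 3 => j < 2) = {0, 1} := by decide
  rw [f1] at h1
  rw [f2, Finset.sum_pair (by decide)] at h2
  rw [Fin.sum_univ_three] at h3
  simp only [EDETDRK3, Coeff.opG, smul_add, Finset.sum_singleton, Matrix.cons_val_zero,
    Matrix.cons_val_one, Matrix.cons_val, List.map_cons, List.map_nil, List.sum_cons, List.sum_nil,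
    add_zero, zero_mul, hT.zero_apply, smul_opG_term_one S T hτ0 _ one_ne_zero,
    smul_opG_term_two S T hτ0 _ one_ne_zero,
    smul_opG_term_one S T hτ0 _ (by norm_num : (2 / 3 : ℝ) ≠ 0),
    smul_opG_term_two S T hτ0 _ (by norm_num : (2 / 3 : ℝ) ≠ 0), hg, ← hΦ₆, ← hΦ₉, map_sub,
    one_mul] at h0 h1 h2 h3
  simp only [Fin.sum_univ_three, linCombEDETDRK3, LinComb.op, Symb.op, Matrix.cons_val_zero,
    Matrix.cons_val_one, Matrix.cons_val, List.map_cons, List.map_nil, List.sum_cons, List.sum_nil,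
    Nat.cast_ofNat, Nat.cast_zero, zero_div, zero_mul, hT.zero_apply, e6, ← hΦ₆, div_self
    (by norm_num : (9 : ℝ) ≠ 0), one_mul, ← hΦ₉]
  refine ⟨by simpa using h0, ?_, ?_, ?_⟩
  -- Substituting `K (g v_j) = K w - K (q j)`, the semigroup terms in `K w` cancel because each row
  -- of the tableau satisfies `exp(c z) = 1 + z ∑ a_j(z)`, and likewise for `b`.
  · rw [h1]; module
  · rw [h2]; module
  · rw [h3]; module

theorem EDETDRK3b_unconditionallyDecreasesEnergy
    (hpos : ∀ z < 0, (EDETDRK3b.Delta' z).PosDef) :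
    Tableau.UnconditionallyDecreasesEnergy.{w} EDETDRK3b := by
  refine Tableau.unconditionallyDecreasesEnergy_of_linComb hpos linCombEDETDRK3b
    (fun z hz => linCombEDETDRK3b_val hz) ?_
  intro H _ _ _ S T hT τ hτ w v q u' h hq
  have hτ0 : τ ≠ 0 := hτ.ne'
  have hg : ∀ j, S.K (S.g (v j)) = S.K w - S.K (q j) := fun j => by
    rw [hq, map_sub, sub_sub_cancel]
  obtain ⟨Φ₆, hΦ₆⟩ := hT.exists_phiOp_one_eq (t := 2 / 3 * τ) (by positivity)
  obtain ⟨Φ₉, hΦ₉⟩ := hT.exists_phiOp_one_eq (t := τ) hτ.le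
  have e6 : (6 / 9 * τ : ℝ) = 2 / 3 * τ := by ring
  have h0 := h.stage 0
  have h1 := h.stage 1
  have h2 := h.stage 2
  have h3 := h.next
  have f1 : (Finset.univ.filter fun j : Fin 3 => j < 1) = {0} := by decide
  have f2 : (Finset.univ.filter fun j : Fin 3 => j < 2) = {0, 1} := by decide
  rw [f1] at h1
  rw [f2, Finset.sum_pair (by decide)] at h2
  rw [Fin.sum_univ_three] at h3
  simp only [EDETDRK3b, Coeff.opG, smul_add, Finset.sum_singleton, Matrix.cons_val_zero,
    Matrix.cons_val_one, Matrix.cons_val, List.map_cons, List.map_nil, List.sum_cons, List.sum_nil,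
    add_zero, zero_mul, hT.zero_apply, smul_opG_term_one S T hτ0 _ one_ne_zero,
    smul_opG_term_two S T hτ0 _ one_ne_zero,
    smul_opG_term_one S T hτ0 _ (by norm_num : (2 / 3 : ℝ) ≠ 0),
    smul_opG_term_two S T hτ0 _ (by norm_num : (2 / 3 : ℝ) ≠ 0),
    smul_opG_term_one S T hτ0 _ (by norm_num : (4 / 9 : ℝ) ≠ 0), hg, ← hΦ₆, ← hΦ₉, map_sub,
    one_mul] at h0 h1 h2 h3
  simp only [Fin.sum_univ_three, linCombEDETDRK3b, LinComb.op, Symb.op, Matrix.cons_val_zero,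
    Matrix.cons_val_one, Matrix.cons_val, List.map_cons, List.map_nil, List.sum_cons, List.sum_nil,
    Nat.cast_ofNat, Nat.cast_zero, zero_div, zero_mul, hT.zero_apply, e6, ← hΦ₆, div_self
    (by norm_num : (9 : ℝ) ≠ 0), one_mul, ← hΦ₉]
  refine ⟨by simpa using h0, ?_, ?_, ?_⟩
  · rw [h1]; module
  · rw [h2]; module
  · rw [h3]; module

end ETDRK

/-! ### The proposition for both schemes. -/

theorem proposition3p1 (tab : ETDRK.Tableau 3)
    (htab : tab = ETDRK.EDETDRK3 ∨ tab = ETDRK.EDETDRK3b) :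
    (∀ z : ℝ, z < 0 →
      (∀ (k : ℕ) (hk : k ≤ 3),
        0 < ((tab.Delta' z).submatrix (Fin.castLE hk) (Fin.castLE hk)).det) ∧
      (tab.Delta' z).PosDef) ∧
    ETDRK.Tableau.UnconditionallyDecreasesEnergy.{w} tab := by
  have hmin : ∀ z < 0, 0 < tab.Delta' z 0 0 ∧
      0 < tab.Delta' z 0 0 * tab.Delta' z 1 1 - tab.Delta' z 0 1 * tab.Delta' z 1 0 ∧
      0 < (tab.Delta' z).det := by
    rcases htab with rfl | rfl
    · exact fun z hz => ETDRK.EDETDRK3_minors hz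
    · exact fun z hz => ETDRK.EDETDRK3b_minors hz
  have hpos : ∀ z < 0, (tab.Delta' z).PosDef := fun z hz =>
    ETDRK.posDef_of_leadingMinor_pos (tab.transpose_Delta' z) (hmin z hz).1 (hmin z hz).2.1
      (hmin z hz).2.2
  refine ⟨fun z hz => ⟨fun k hk => ETDRK.leadingMinor_pos (hmin z hz).1 (hmin z hz).2.1
    (hmin z hz).2.2 k hk, hpos z hz⟩, ?_⟩
  rcases htab with rfl | rfl
  · exact ETDRK.EDETDRK3_unconditionallyDecreasesEnergy hpos
  · exact ETDRK.EDETDRK3b_unconditionallyDecreasesEnergy hpos
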